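/- Let $\{\varepsilon_{in}\}_{1\le i\le n,\,n\ge1}$ be a triangular array of real random variables on a probability space $(\Omega,\mathcal F,\mathbb P)$ such that, for each $n$, $\varepsilon_{1n},\dots,\varepsilon_{nn}$ are independent and each $\varepsilon_{in}$ is distributed symmetrically about $0$ (the distributions may differ). Let $\mu_n\in\mathbb R$ and $X_{in}=\mu_n+\varepsilon_{in}$. Suppose that $$\liminf_{n\to\infty}\frac1n\sum_{i=1}^n\mathbb E[\varepsilon_{in}^2]>0,\qquad \limsup_{n\to\infty}\frac1n\sum_{i=1}^n\mathbb E\big[|\varepsilon_{in}|^{4+\delta}\big]<\infty\ \text{ for some }\delta>0,\qquad \mu_n\to0.$$ For each $n$ let $\pi_{1n},\dots,\pi_{nn}$ be i.i.d. with $\mathbb P[\pi_{in}=1]=\mathbb P[\pi_{in}=-1]=\tfrac12$, independent of $(\varepsilon_{1n},\dots,\varepsilon_{nn})$, and put $\mathcal F_n=\sigma(X_{1n},\dots,X_{nn})$. Then the saddlepoint equation $$\sum_{i=1}^n\frac{X_{in}}{1+\exp(2sX_{in})}=0$$ has exactly one solution $s\in[-1,1]$ with probability tending to $1$ as $n\to\infty$.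 Furthermore, let $\hat s_n$ be the solution of this equation in $[-1,1]$ if it has exactly one there, and $\hat s_n=\mathrm{sgn}\big(\tfrac1n\sum_{i=1}^n X_{in}\big)$ otherwise, and define $$\lambda_n=\hat s_n\sqrt{\sum_{i=1}^n\frac{4X_{in}^2\exp(2\hat s_nX_{in})}{(1+\exp(2\hat s_nX_{in}))^2}},\qquad r_n=\mathrm{sgn}(\hat s_n)\sqrt{2\sum_{i=1}^n\big(\hat s_nX_{in}-\log\cosh(\hat s_nX_{in})\big)},$$ with $r_n=\mathrm{sgn}(\hat s_n)$ when the quantity under the latter square root is negative. Let $$\hat p_n=1-\Phi(r_n)+\phi(r_n)\Big\{\frac1{\lambda_n}-\frac1{r_n}\Big\},$$ where $\Phi$ and $\phi$ are the standard normal distribution function and density, and $\tfrac10-\tfrac10=0$ by convention. Then the Lugannani-Rice approximation $\hat p_n$ to the sign-flipping p-value has vanishing relative error: $$\mathbb P\Big[\frac1n\sum_{i=1}^n\pi_{in}X_{in}\ge\frac1n\sum_{i=1}^nX_{in}\,\Big|\,\mathcal F_n\Big]=\hat p_n\,(1+o_{\mathbb P}(1)),$$ that is, the ratio of the left-hand side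 to $\hat p_n$ converges to $1$ in probability. -/

import Mathlib

open MeasureTheory ProbabilityTheory Filter Topology
open scoped ENNReal

noncomputable section

namespace SignFlip

/-- The Rademacher law `Rad(0.5)`: mass `1/2` at each of `1` and `-1`. -/
def rademacher : Measure ℝ :=
  (2⁻¹ : ℝ≥0∞) • Measure.dirac (1 : ℝ) + (2⁻¹ : ℝ≥0∞) • Measure.dirac (-1 : ℝ)

/-- The standard normal distribution function `Φ`. -/
def stdNormalCDF (t : ℝ) : ℝ := cdf (gaussianReal 0 1) t

/-- The standard normal density `φ`. -/
def stdNormalPDF (t : ℝ) : ℝ := gaussianPDFReal 0 1 t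

/-- The sample mean `(1/n) ∑ xᵢ`. -/
def mean {n : ℕ} (x : Fin n → ℝ) : ℝ := (1 / (n : ℝ)) * ∑ i, x i

/-- The solutions in `[-1, 1]` of the saddlepoint equation `∑ xᵢ / (1 + exp (2 s xᵢ)) = 0`
for the observed data `x`. -/
def solutionSet {n : ℕ} (x : Fin n → ℝ) : Set ℝ :=
  {s | s ∈ Set.Icc (-1 : ℝ) 1 ∧ ∑ i, x i / (1 + Real.exp (2 * s * x i)) = 0}

open Classical in
/-- The saddlepoint: the unique solution in `[-1, 1]` if there is exactly one, and
the sign of the sample mean otherwise. -/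
def saddlepoint {n : ℕ} (x : Fin n → ℝ) : ℝ :=
  if h : ∃! s, s ∈ solutionSet x then h.exists.choose else Real.sign (mean x)

/-- `λₙ`, as a function of the data. -/
def lam {n : ℕ} (x : Fin n → ℝ) : ℝ :=
  saddlepoint x *
    √(∑ i, 4 * x i ^ 2 * Real.exp (2 * saddlepoint x * x i) /
        (1 + Real.exp (2 * saddlepoint x * x i)) ^ 2)

/-- The quantity under the square root in `rₙ`. -/
def rSq {n : ℕ} (x : Fin n → ℝ) : ℝ :=
  2 * ∑ i, (saddlepoint x * x i - Real.log (Real.cosh (saddlepoint x * x i)))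

/-- `rₙ`, as a function of the data. -/
def rStat {n : ℕ} (x : Fin n → ℝ) : ℝ :=
  if 0 ≤ rSq x then Real.sign (saddlepoint x) * √(rSq x) else Real.sign (saddlepoint x)

/-- The Lugannani-Rice approximation `1 - Φ(r) + φ(r) (1/λ - 1/r)` to the sign-flipping p-value.
For `λ = r = 0`, division by zero gives the convention `1/0 - 1/0 = 0`, so the value is `1/2`. -/
def lugannaniRice {n : ℕ} (x : Fin n → ℝ) : ℝ :=
  1 - stdNormalCDF (rStat x) + stdNormalPDF (rStat x) * (1 / lam x - 1 / rStat x)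

/-- The σ-algebra `σ(X₁, …, Xₙ)` generated by the data. -/
abbrev dataSigma {Ω : Type*} {n : ℕ} (X : Fin n → Ω → ℝ) : MeasurableSpace Ω :=
  ⨆ i, MeasurableSpace.comap (X i) inferInstance

/-- The sign-flipping p-value: the conditional probability, given the data `X₁, …, Xₙ`, that the
mean of the sign-flipped data `πᵢ Xᵢ` is at least the mean of the data. -/
def pValue {Ω : Type*} [MeasurableSpace Ω] (P : Measure Ω) {n : ℕ}
    (π X : Fin n → Ω → ℝ) : Ω → ℝ :=
  P⟦{ω | mean (fun i => X i ω) ≤ mean (fun i => π i ω * X i ω)} | dataSigma X⟧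

/-- `W n = o_P(1)`. -/
def IsLittleOP {Ω : Type*} [MeasurableSpace Ω] (P : Measure Ω) (W : ℕ → Ω → ℝ) : Prop :=
  ∀ η : ℝ, 0 < η → Tendsto (fun n => P {ω | η < |W n ω|}) atTop (𝓝 0)

/-- `p n = q n * (1 + o_P(1))`, in the form `p n / q n - 1 = o_P(1)`. Where `q n = 0` the quotient
is `0`, so such outcomes count as having relative error `1`: they must have vanishing
probability too. -/
def VanishingRelativeError {Ω : Type*} [MeasurableSpace Ω] (P : Measure Ω)
    (p q : ℕ → Ω → ℝ) : Prop :=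
  IsLittleOP P (fun n ω => p n ω / q n ω - 1)

end SignFlip

end

noncomputable section

namespace SignFlip

/-! ### Elementary inequalities -/

/-! Given the data `x`, the p-value is a deterministic function `flipProb x`, a proportion of sign
vectors (`pValue_ae_eq_flipProb`). With `B = ∑ xᵢ²`, everything is reduced to a deterministic
statement, `exists_uniform_bound`: the relative error is small as soon as `B` is large, `∑ xᵢ⁴ ≤ D
B` and `|∑ xᵢ|` is small compared with `B`. Chebyshev and Markov show that random data meet these
conditions with probability close to one (`exists_forall_eventually_measure_le`).

The saddlepoint `s` is the tilt under which the flipped sum has mean `∑ xᵢ`. A small mean forces `s`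
to be small, and then `r`, `λ` and the standardised sum `∑ xᵢ / √B` all equal `s √B` up to factors
`1 + O(D s²)` (`exists_statistics_eq`). The uniform bound is proved by contradiction: from a
sequence of counterexamples, compactness of `EReal` extracts a subsequence along which `s √B`
converges to some `l`.

For finite `l` the central limit theorem sends both the p-value and its approximation to `1 - Φ(l) >
0`; for `l = -∞` both tend to `1`. For `l = +∞` both may tend to `0`, and exponential tilting gives
the p-value as `exp (-r²/2)` times `E[exp (-Y); Y ≥ 0]`, with `Y` the tilted centred sum times `s`.
A local limit theorem (`Regime.tendsto_integral_tiltLaw`) shows that this expectation is asymptotic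
to `1 / (√(2π) s √B)`, which matches Mills' ratio for the approximation.

The local limit theorem needs no non-lattice condition: `Y` lives on a scale where only frequencies
of order `s → 0` of the original sum matter. A positive kernel with compactly supported Fourier
transform makes this precise. -/

lemma hasDerivAt_tanh (u : ℝ) : HasDerivAt Real.tanh (1 - Real.tanh u ^ 2) u := by
  have hc : Real.cosh u ≠ 0 := (Real.cosh_pos u).ne'
  have h := (Real.hasDerivAt_sinh u).div (Real.hasDerivAt_cosh u) hc
  have he : (Real.sinh / Real.cosh) = Real.tanh := by
    funext v; simp [Real.tanh_eq_sinh_div_cosh]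
  rw [he] at h
  refine h.congr_deriv ?_
  rw [Real.tanh_eq_sinh_div_cosh]
  field_simp

lemma hasDerivAt_log_cosh (u : ℝ) :
    HasDerivAt (fun v => Real.log (Real.cosh v)) (Real.tanh u) u := by
  have h := (Real.hasDerivAt_cosh u).log (Real.cosh_pos u).ne'
  rwa [← Real.tanh_eq_sinh_div_cosh] at h

lemma continuous_tanh : Continuous Real.tanh :=
  continuous_iff_continuousAt.2 fun u => (hasDerivAt_tanh u).continuousAt

lemma strictMono_tanh : StrictMono Real.tanh :=
  strictMono_of_deriv_pos fun u => by
    rw [(hasDerivAt_tanh u).deriv]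
    linarith [Real.tanh_sq_lt_one u]

/-- A function on `[0, ∞)` with nonnegative derivative that vanishes at `0` is nonnegative. -/
lemma nonneg_of_hasDerivAt_nonneg {f f' : ℝ → ℝ} (h0 : f 0 = 0)
    (hd : ∀ u, HasDerivAt f (f' u) u) (hf : ∀ u, 0 ≤ u → 0 ≤ f' u) {u : ℝ} (hu : 0 ≤ u) :
    0 ≤ f u := by
  have hm : MonotoneOn f (Set.Ici 0) := by
    refine monotoneOn_of_deriv_nonneg (convex_Ici 0)
      (fun v _ => (hd v).continuousAt.continuousWithinAt)
      (fun v _ => (hd v).differentiableAt.differentiableWithinAt) fun v hv => ?_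
    rw [interior_Ici] at hv
    rw [(hd v).deriv]
    exact hf v (le_of_lt hv)
  simpa [h0] using hm (Set.self_mem_Ici) hu hu

lemma tanh_nonneg {u : ℝ} (hu : 0 ≤ u) : 0 ≤ Real.tanh u := by
  simpa using strictMono_tanh.monotone hu

lemma tanh_le_self {u : ℝ} (hu : 0 ≤ u) : Real.tanh u ≤ u := by
  have := nonneg_of_hasDerivAt_nonneg (f := fun v => v - Real.tanh v) (by simp)
    (fun v => (hasDerivAt_id v).sub (hasDerivAt_tanh v))
    (fun v _ => by nlinarith [sq_nonneg (Real.tanh v)]) hu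
  simpa using this

lemma sub_cube_le_tanh {u : ℝ} (hu : 0 ≤ u) : u - u ^ 3 / 3 ≤ Real.tanh u := by
  have := nonneg_of_hasDerivAt_nonneg (f := fun v => Real.tanh v - (v - v ^ 3 / 3)) (by simp)
    (f' := fun v => v ^ 2 - Real.tanh v ^ 2)
    (fun v => by
      refine ((hasDerivAt_tanh v).sub
        ((hasDerivAt_id v).sub (((hasDerivAt_id v).pow 3).div_const 3))).congr_deriv ?_
      simp)
    (fun v hv => by nlinarith [tanh_nonneg hv, tanh_le_self hv]) hu
  simpa using this

lemma log_cosh_ge {u : ℝ} (hu : 0 ≤ u) :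
    u ^ 2 / 2 - u ^ 4 / 12 ≤ Real.log (Real.cosh u) := by
  have := nonneg_of_hasDerivAt_nonneg
    (f := fun v => Real.log (Real.cosh v) - (v ^ 2 / 2 - v ^ 4 / 12)) (by simp)
    (f' := fun v => Real.tanh v - (v - v ^ 3 / 3))
    (fun v => by
      refine ((hasDerivAt_log_cosh v).sub ((((hasDerivAt_id v).pow 2).div_const 2).sub
        (((hasDerivAt_id v).pow 4).div_const 12))).congr_deriv ?_
      simp; ring)
    (fun v hv => by linarith [sub_cube_le_tanh hv]) hu
  simpa using this

lemma log_cosh_le (u : ℝ) : Real.log (Real.cosh u) ≤ u ^ 2 / 2 :=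
  (Real.log_le_iff_le_exp (Real.cosh_pos u)).2 (Real.cosh_le_exp_half_sq u)

lemma tanh_sq_le (u : ℝ) : Real.tanh u ^ 2 ≤ u ^ 2 := by
  rcases le_total 0 u with h | h
  · exact pow_le_pow_left₀ (tanh_nonneg h) (tanh_le_self h) 2
  · have h' : 0 ≤ -u := by linarith
    have := pow_le_pow_left₀ (tanh_nonneg h') (tanh_le_self h') 2
    simpa using this

lemma mul_tanh_le (u : ℝ) : u * Real.tanh u ≤ u ^ 2 := by
  nlinarith [tanh_sq_le u, sq_nonneg (u - Real.tanh u)]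

lemma mul_tanh_ge (u : ℝ) : u ^ 2 - u ^ 4 / 3 ≤ u * Real.tanh u := by
  rcases le_total 0 u with h | h
  · nlinarith [sub_cube_le_tanh h]
  · have h' : 0 ≤ -u := by linarith
    have := sub_cube_le_tanh h'
    rw [Real.tanh_neg] at this
    nlinarith

/-- The signed root statistic has `ψ(u) = 2 (u tanh u - log cosh u) = u² + O(u⁴)`. -/
lemma abs_two_mul_tanh_sub_log_cosh (u : ℝ) :
    |2 * (u * Real.tanh u - Real.log (Real.cosh u)) - u ^ 2| ≤ u ^ 4 := by
  have hlc : u ^ 2 / 2 - u ^ 4 / 12 ≤ Real.log (Real.cosh u) := by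
    rcases le_total 0 u with h | h
    · exact log_cosh_ge h
    · have := log_cosh_ge (u := -u) (by linarith)
      rw [Real.cosh_neg] at this
      convert this using 1; ring
  rw [abs_le]
  have h4 : 0 ≤ u ^ 4 := by positivity
  constructor <;> nlinarith [mul_tanh_le u, mul_tanh_ge u, log_cosh_le u]

/-- Puts the summands of `lam` in the form `x² (1 - tanh² (s x))`, the tilted variances of the
single flips. -/
lemma exp_two_mul_div_eq (u : ℝ) :
    4 * Real.exp (2 * u) / (1 + Real.exp (2 * u)) ^ 2 = 1 - Real.tanh u ^ 2 := by
  have h1 : Real.exp (2 * u) = Real.exp u ^ 2 := by rw [← Real.exp_nat_mul]; norm_num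
  have h2 : Real.exp (-u) = (Real.exp u)⁻¹ := Real.exp_neg u
  rw [Real.tanh_eq, h1, h2]
  have hp := Real.exp_pos u
  field_simp
  ring

lemma inv_one_add_exp_eq (u : ℝ) :
    1 / (1 + Real.exp (2 * u)) = (1 - Real.tanh u) / 2 := by
  have h1 : Real.exp (2 * u) = Real.exp u ^ 2 := by rw [← Real.exp_nat_mul]; norm_num
  have h2 : Real.exp (-u) = (Real.exp u)⁻¹ := Real.exp_neg u
  rw [Real.tanh_eq, h1, h2]
  have hp := Real.exp_pos u
  field_simp
  ring

lemma abs_sq_mul_one_sub_tanh_sq (u : ℝ) :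
    |u ^ 2 * (1 - Real.tanh u ^ 2) - u ^ 2| ≤ u ^ 4 := by
  rw [abs_le]
  have h4 : 0 ≤ u ^ 4 := by positivity
  constructor <;> nlinarith [mul_le_mul_of_nonneg_left (tanh_sq_le u) (sq_nonneg u),
    mul_nonneg (sq_nonneg u) (sq_nonneg (Real.tanh u))]

/-- Taylor's formula for `|q| ≤ 1`, trivial bounds beyond. This and the next bounds are global, so
that the data need no truncation. -/
lemma abs_sin_sub_self_le (q : ℝ) : |Real.sin q - q| ≤ 2 * |q| ^ 3 := by
  rcases le_total |q| 1 with h | h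
  · have h1 := Real.sin_bound h
    have h2 : |Real.sin q - q| ≤ |Real.sin q - (q - q ^ 3 / 6)| + |q| ^ 3 / 6 := by
      have : Real.sin q - q = (Real.sin q - (q - q ^ 3 / 6)) + (- (q ^ 3 / 6)) := by ring
      rw [this]
      refine (abs_add_le _ _).trans ?_
      rw [abs_neg, abs_div, abs_pow]; norm_num
    have h3 : |q| ^ 5 ≤ |q| ^ 3 := pow_le_pow_of_le_one (abs_nonneg q) h (by norm_num)
    have h4 : 0 ≤ |q| ^ 3 := by positivity
    linarith
  · have h1 : |Real.sin q - q| ≤ |q| + |q| :=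
      (abs_sub _ _).trans (add_le_add Real.abs_sin_le_abs le_rfl)
    nlinarith [le_self_pow₀ h (n := 3) (by norm_num)]

lemma abs_cos_sub_le (q : ℝ) : |Real.cos q - (1 - q ^ 2 / 2)| ≤ q ^ 4 := by
  have hq4 : |q| ^ 4 = q ^ 4 := by rw [← abs_pow, abs_of_nonneg (by positivity)]
  rcases le_total |q| 1 with h | h
  · have h1 := Real.cos_bound h
    rw [hq4] at h1
    have : 0 ≤ q ^ 4 := by positivity
    linarith
  · have h1 := Real.one_sub_sq_div_two_le_cos (x := q)
    have h2 := Real.cos_le_one q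
    have h3 : 1 ≤ q ^ 2 := by rw [← sq_abs]; nlinarith
    rw [abs_le]; constructor <;> nlinarith

lemma sin_sq_ge (q : ℝ) : q ^ 2 - q ^ 4 ≤ Real.sin q ^ 2 := by
  wlog hq : 0 ≤ q generalizing q
  · have := this (-q) (by linarith)
    rwa [Real.sin_neg, neg_sq, neg_sq, (show Even 4 by decide).neg_pow] at this
  rcases le_total q 1 with h | h
  · rcases hq.eq_or_lt with rfl | h0
    · simp
    have h1 := (Real.sin_gt_sub_cube h0).le
    have h2 : 0 ≤ q - q ^ 3 / 6 := by nlinarith [pow_le_pow_left₀ hq h 2]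
    have h3 := pow_le_pow_left₀ h2 h1 2
    nlinarith [pow_nonneg hq 6, pow_nonneg hq 4]
  · nlinarith [sq_nonneg (Real.sin q), mul_le_mul h h zero_le_one hq]

lemma abs_exp_neg_sub_le {y : ℝ} (hy : 0 ≤ y) : |Real.exp (-y) - (1 - y)| ≤ y ^ 2 := by
  rcases le_total y 1 with h | h
  · have := Real.abs_exp_sub_one_sub_id_le (x := -y) (by rwa [abs_neg, abs_of_nonneg hy])
    rwa [neg_sq, show Real.exp (-y) - 1 - -y = Real.exp (-y) - (1 - y) by ring] at this
  · have h1 := Real.add_one_le_exp (-y)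
    have h2 : Real.exp (-y) ≤ 1 := Real.exp_le_one_iff.2 (by linarith)
    rw [abs_le]; constructor <;> nlinarith

/-! ### The exponentially tilted law of a sum of sign-flipped numbers -/

/-- The sign `±1` encoded by a Boolean. -/
def sgn (b : Bool) : ℝ := if b then 1 else -1

/-- The sum of the numbers `xᵢ` with signs `σᵢ`. -/
def signSum {n : ℕ} (x : Fin n → ℝ) (σ : Fin n → Bool) : ℝ := ∑ i, sgn (σ i) * x i

/-- The mass of the sign vector `σ` under the measure tilted by `exp (s ∑ σᵢ xᵢ)`. -/
def tiltWeight {n : ℕ} (x : Fin n → ℝ) (s : ℝ) (σ : Fin n → Bool) : ℝ :=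
  ∏ i, Real.exp (s * (sgn (σ i) * x i)) / (2 * Real.cosh (s * x i))

/-- The mean of the sum of sign-flipped numbers under the tilted measure. -/
def tiltMean {n : ℕ} (x : Fin n → ℝ) (s : ℝ) : ℝ := ∑ i, x i * Real.tanh (s * x i)

/-- The law of the centred and scaled sum of sign-flipped numbers under the tilted measure. -/
def tiltLaw {n : ℕ} (x : Fin n → ℝ) (s ρ : ℝ) : Measure ℝ :=
  ∑ σ, ENNReal.ofReal (tiltWeight x s σ) • Measure.dirac (ρ * (signSum x σ - tiltMean x s))

/-- The characteristic function of one centred summand under the tilted measure. -/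
def tiltFactor (x s u : ℝ) : ℂ :=
  Complex.exp (-(u * x * Real.tanh (s * x) : ℝ) * Complex.I) *
    (Real.cos (u * x) + Real.tanh (s * x) * Real.sin (u * x) * Complex.I)

lemma tiltWeight_nonneg {n : ℕ} (x : Fin n → ℝ) (s : ℝ) (σ : Fin n → Bool) :
    0 ≤ tiltWeight x s σ :=
  Finset.prod_nonneg fun _ _ =>
    div_nonneg (Real.exp_pos _).le (mul_pos two_pos (Real.cosh_pos _)).le

/-- Independence of the signs under product weights, in algebraic form: sums over sign vectors
factor over coordinates. -/
lemma sum_prod_bool {R : Type*} [CommSemiring R] {n : ℕ} (f : Fin n → Bool → R) :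
    ∑ σ : Fin n → Bool, ∏ i, f i (σ i) = ∏ i, (f i true + f i false) := by
  have := (Finset.prod_univ_sum (fun _ : Fin n => (Finset.univ : Finset Bool)) f).symm
  rw [Fintype.piFinset_univ] at this
  rw [this]
  simp

lemma sum_tiltWeight {n : ℕ} (x : Fin n → ℝ) (s : ℝ) : ∑ σ, tiltWeight x s σ = 1 := by
  unfold tiltWeight
  rw [sum_prod_bool fun i b => Real.exp (s * (sgn b * x i)) / (2 * Real.cosh (s * x i))]
  refine Finset.prod_eq_one fun i _ => ?_
  have hc := Real.cosh_pos (s * x i)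
  have h : Real.exp (s * x i) + Real.exp (-(s * x i)) = 2 * Real.cosh (s * x i) := by
    rw [Real.cosh_eq]; ring
  simp only [sgn, if_true, Bool.false_eq_true, if_false, one_mul, neg_mul, mul_neg]
  rw [← add_div, h, div_self (by positivity)]

lemma tiltWeight_zero {n : ℕ} (x : Fin n → ℝ) (σ : Fin n → Bool) :
    tiltWeight x 0 σ = (2 ^ n)⁻¹ := by
  simp [tiltWeight]

lemma tiltMean_zero {n : ℕ} (x : Fin n → ℝ) : tiltMean x 0 = 0 := by simp [tiltMean]

instance {n : ℕ} (x : Fin n → ℝ) (s ρ : ℝ) : IsProbabilityMeasure (tiltLaw x s ρ) := by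
  constructor
  simp only [tiltLaw, Measure.finsetSum_apply, Measure.smul_apply, measure_univ, smul_eq_mul,
    mul_one]
  rw [← ENNReal.ofReal_sum_of_nonneg fun σ _ => tiltWeight_nonneg x s σ, sum_tiltWeight,
    ENNReal.ofReal_one]

lemma integral_tiltLaw {E : Type*} [NormedAddCommGroup E] [NormedSpace ℝ E] [CompleteSpace E]
    {n : ℕ} (x : Fin n → ℝ) (s ρ : ℝ) (f : ℝ → E) :
    ∫ y, f y ∂tiltLaw x s ρ =
      ∑ σ, tiltWeight x s σ • f (ρ * (signSum x σ - tiltMean x s)) := by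
  unfold tiltLaw
  rw [integral_finsetSum_measure]
  · refine Finset.sum_congr rfl fun σ _ => ?_
    rw [integral_smul_measure, integral_dirac, ENNReal.toReal_ofReal (tiltWeight_nonneg x s σ)]
  · intro σ _
    exact (integrable_dirac (by simp)).smul_measure ENNReal.ofReal_ne_top

/-- Since `exp (± s x) = cosh ± sinh`, the tilted sign probabilities are `(1 ± tanh (s x)) / 2`, and
averaging `exp (± i u x)` gives `cos + i tanh · sin`. -/
lemma tiltFactor_eq (x s u : ℝ) :
    (Real.exp (s * (sgn true * x)) / (2 * Real.cosh (s * x)) : ℝ) *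
        Complex.exp ((u * (sgn true * x - x * Real.tanh (s * x)) : ℝ) * Complex.I) +
      (Real.exp (s * (sgn false * x)) / (2 * Real.cosh (s * x)) : ℝ) *
        Complex.exp ((u * (sgn false * x - x * Real.tanh (s * x)) : ℝ) * Complex.I) =
      tiltFactor x s u := by
  have hc := (Real.cosh_pos (s * x)).ne'
  have hcC : (Real.cosh (s * x) : ℂ) ≠ 0 := by exact_mod_cast hc
  have e1 : Complex.exp ((u * (sgn true * x - x * Real.tanh (s * x)) : ℝ) * Complex.I) =
      Complex.exp (-(u * x * Real.tanh (s * x) : ℝ) * Complex.I) *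
        (Real.cos (u * x) + Real.sin (u * x) * Complex.I) := by
    rw [Complex.ofReal_cos, Complex.ofReal_sin, ← Complex.exp_mul_I, ← Complex.exp_add]
    congr 1; simp [sgn]; ring
  have e2 : Complex.exp ((u * (sgn false * x - x * Real.tanh (s * x)) : ℝ) * Complex.I) =
      Complex.exp (-(u * x * Real.tanh (s * x) : ℝ) * Complex.I) *
        (Real.cos (u * x) - Real.sin (u * x) * Complex.I) := by
    have : (Real.cos (u * x) : ℂ) - Real.sin (u * x) * Complex.I
        = Complex.cos (-(u * x : ℝ) : ℂ) + Complex.sin (-(u * x : ℝ) : ℂ) * Complex.I := by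
      simp; ring
    rw [this, ← Complex.exp_mul_I, ← Complex.exp_add]
    congr 1; simp [sgn]; ring
  rw [e1, e2, tiltFactor]
  have hp : Real.exp (s * (sgn true * x)) = Real.cosh (s * x) + Real.sinh (s * x) := by
    simp [sgn, Real.cosh_add_sinh]
  have hm : Real.exp (s * (sgn false * x)) = Real.cosh (s * x) - Real.sinh (s * x) := by
    simp [sgn, Real.cosh_sub_sinh]
  rw [hp, hm, Real.tanh_eq_sinh_div_cosh]
  push_cast at hcC ⊢
  field_simp
  ring

lemma sum_tiltWeight_mul_cexp {n : ℕ} (x : Fin n → ℝ) (s u : ℝ) :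
    ∑ σ, (tiltWeight x s σ : ℂ) *
        Complex.exp ((u * (signSum x σ - tiltMean x s) : ℝ) * Complex.I) =
      ∏ i, tiltFactor (x i) s u := by
  simp_rw [← tiltFactor_eq]
  rw [← sum_prod_bool fun i b =>
    (Real.exp (s * (sgn b * x i)) / (2 * Real.cosh (s * x i)) : ℝ) *
        Complex.exp ((u * (sgn b * x i - x i * Real.tanh (s * x i)) : ℝ) * Complex.I)]
  refine Finset.sum_congr rfl fun σ _ => ?_
  rw [Finset.prod_mul_distrib, ← Complex.exp_sum, tiltWeight, Complex.ofReal_prod]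
  congr 2
  rw [← Finset.sum_mul, ← Complex.ofReal_sum, ← Finset.mul_sum, Finset.sum_sub_distrib]
  rfl

lemma charFun_tiltLaw {n : ℕ} (x : Fin n → ℝ) (s ρ t : ℝ) :
    charFun (tiltLaw x s ρ) t = ∏ i, tiltFactor (x i) s (t * ρ) := by
  rw [charFun_apply_real, integral_tiltLaw, ← sum_tiltWeight_mul_cexp]
  refine Finset.sum_congr rfl fun σ _ => ?_
  rw [Complex.real_smul]
  congr 2
  push_cast; ring

lemma norm_tiltFactor (x s u : ℝ) :
    ‖tiltFactor x s u‖ = ‖(⟨Real.cos (u * x), Real.tanh (s * x) * Real.sin (u * x)⟩ : ℂ)‖ := by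
  rw [tiltFactor, norm_mul, ← Complex.ofReal_neg, Complex.norm_exp_ofReal_mul_I, one_mul]
  congr 1
  apply Complex.ext <;>
    simp [-Complex.ofReal_cos, -Complex.ofReal_sin, -Complex.ofReal_tanh]

lemma norm_tiltFactor_sq (x s u : ℝ) :
    ‖tiltFactor x s u‖ ^ 2 = 1 - (1 - Real.tanh (s * x) ^ 2) * Real.sin (u * x) ^ 2 := by
  rw [norm_tiltFactor, Complex.sq_norm, Complex.normSq_mk]
  nlinarith [Real.sin_sq_add_cos_sq (u * x)]

lemma norm_tiltFactor_le_one (x s u : ℝ) : ‖tiltFactor x s u‖ ≤ 1 := by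
  have := norm_tiltFactor_sq x s u
  have h : 0 ≤ (1 - Real.tanh (s * x) ^ 2) * Real.sin (u * x) ^ 2 :=
    mul_nonneg (by linarith [Real.tanh_sq_lt_one (s * x)]) (sq_nonneg _)
  exact (sq_le_one_iff₀ (norm_nonneg _)).1 (by linarith)

/-- Insert `sin² q ≥ q² - q⁴` and `tanh² (s x) ≤ (s x)²` into the exact squared modulus, then use `1
- y ≤ exp (-y)`. -/
lemma norm_tiltFactor_le_exp (x s u : ℝ) :
    ‖tiltFactor x s u‖ ≤
      Real.exp (-(u ^ 2 * (x ^ 2 - (u ^ 2 + s ^ 2) * x ^ 4)) / 2) := by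
  refine le_of_sq_le_sq ?_ (Real.exp_pos _).le
  rw [norm_tiltFactor_sq, ← Real.exp_nat_mul]
  refine le_trans ?_ (Real.add_one_le_exp _)
  have h1 := sin_sq_ge (u * x)
  have h2 : Real.sin (u * x) ^ 2 ≤ (u * x) ^ 2 := Real.sin_sq_le_sq
  have h3 := tanh_sq_le (s * x)
  have h4 := mul_le_mul h3 h2 (sq_nonneg _) (sq_nonneg _)
  push_cast
  nlinarith

/-- The fourth-power correction eats at most half of `u² ∑ xᵢ²`, which leaves Gaussian decay for all
frequencies below a fixed threshold. This is the domination in the local limit theorem. -/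
lemma norm_prod_tiltFactor_le {n : ℕ} (x : Fin n → ℝ) {s u D : ℝ}
    (hD : ∑ i, x i ^ 4 ≤ D * ∑ i, x i ^ 2) (hu : D * (u ^ 2 + s ^ 2) ≤ 1 / 2) :
    ‖∏ i, tiltFactor (x i) s u‖ ≤ Real.exp (-(u ^ 2 * ∑ i, x i ^ 2) / 4) := by
  rw [norm_prod]
  refine (Finset.prod_le_prod (fun i _ => norm_nonneg _)
    fun i _ => norm_tiltFactor_le_exp (x i) s u).trans ?_
  rw [← Real.exp_sum, Real.exp_le_exp, ← Finset.sum_div, Finset.sum_neg_distrib,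
    ← Finset.mul_sum, Finset.sum_sub_distrib, ← Finset.mul_sum]
  have h0 : 0 ≤ ∑ i, x i ^ 2 := Finset.sum_nonneg fun i _ => sq_nonneg _
  have h1 : (u ^ 2 + s ^ 2) * ∑ i, x i ^ 4 ≤ 1 / 2 * ∑ i, x i ^ 2 :=
    calc _ ≤ (u ^ 2 + s ^ 2) * (D * ∑ i, x i ^ 2) := by gcongr
      _ = D * (u ^ 2 + s ^ 2) * ∑ i, x i ^ 2 := by ring
      _ ≤ _ := by gcongr
  nlinarith [mul_le_mul_of_nonneg_left h1 (sq_nonneg u)]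

/-- Centring removes the linear term and the tilt lowers the variance only by `O(s² x⁴)`, so a
factor differs from the Gaussian one by terms of order three and four in `x`. -/
lemma norm_tiltFactor_sub_exp_le (x s u : ℝ) :
    ‖tiltFactor x s u - Complex.exp (-(u ^ 2 * x ^ 2 / 2 : ℝ))‖ ≤
      2 * u ^ 4 * x ^ 4 + 5 * |u| ^ 3 * |x| ^ 3 + u ^ 2 * s ^ 2 * x ^ 4 := by
  set τ := Real.tanh (s * x) with hτ
  set q := u * x with hq
  have hτ1 : |τ| ≤ 1 := (Real.abs_tanh_lt_one _).le
  have hτ2 : τ ^ 2 ≤ (s * x) ^ 2 := tanh_sq_le _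
  set e := Real.exp (-(q ^ 2 / 2)) with he
  have he0 : 0 < e := Real.exp_pos _
  have he1 : e ≤ 1 := Real.exp_le_one_iff.2 (by linarith [sq_nonneg q])
  -- The unimodular phase of the centring is factored out, so that real and imaginary parts can be
  -- compared separately.
  have heq : tiltFactor x s u - Complex.exp (-(u ^ 2 * x ^ 2 / 2 : ℝ)) =
      Complex.exp (-(q * τ : ℝ) * Complex.I) *
        (((Real.cos q - Real.cos (q * τ) * e : ℝ) : ℂ) +
          ((τ * Real.sin q - Real.sin (q * τ) * e : ℝ) : ℂ) * Complex.I) := by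
    have h1 : Complex.exp (-(q * τ : ℝ) * Complex.I) *
        (Complex.cos (q * τ : ℝ) + Complex.sin (q * τ : ℝ) * Complex.I) = 1 := by
      rw [← Complex.exp_mul_I, ← Complex.exp_add]; simp
    have h2 : Complex.exp (-(u ^ 2 * x ^ 2 / 2 : ℝ)) = (e : ℂ) := by
      rw [he, hq, Complex.ofReal_exp]; congr 1; push_cast; ring
    rw [h2, tiltFactor, ← hτ, ← hq]
    push_cast at h1 ⊢
    linear_combination (e : ℂ) * h1
  rw [heq, norm_mul, ← Complex.ofReal_neg, Complex.norm_exp_ofReal_mul_I, one_mul]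
  have hre : |Real.cos q - Real.cos (q * τ) * e| ≤ 2 * q ^ 4 + q ^ 2 * τ ^ 2 := by
    have h1 := abs_cos_sub_le q
    have h2 := abs_exp_neg_sub_le (y := q ^ 2 / 2) (by positivity)
    have h3 := Real.one_sub_sq_div_two_le_cos (x := q * τ)
    have h4 := Real.cos_le_one (q * τ)
    have h5 : 0 ≤ e * (1 - Real.cos (q * τ)) := mul_nonneg he0.le (by linarith)
    have h6 : e * (1 - Real.cos (q * τ)) ≤ 1 * ((q * τ) ^ 2 / 2) :=
      mul_le_mul he1 (by linarith) (by linarith) zero_le_one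
    have h7 : 0 ≤ q ^ 4 := by positivity
    rw [abs_le] at h1 h2 ⊢
    rw [← he] at h2
    constructor <;> nlinarith
  -- The linear parts of `τ sin q` and `sin (q τ)` are both `q τ` and cancel; what remains is cubic.
  have him : |τ * Real.sin q - Real.sin (q * τ) * e| ≤ 5 * |q| ^ 3 := by
    have h1 := abs_sin_sub_self_le q
    have h2 := abs_sin_sub_self_le (q * τ)
    have h3 : |q * τ| ≤ |q| := by
      rw [abs_mul]; exact mul_le_of_le_one_right (abs_nonneg _) hτ1
    have h4 : 1 - e ≤ q ^ 2 / 2 := by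
      have := Real.add_one_le_exp (-(q ^ 2 / 2)); rw [← he] at this; linarith
    have h5 : τ * Real.sin q - Real.sin (q * τ) * e =
        τ * (Real.sin q - q) + -(Real.sin (q * τ) - q * τ) + Real.sin (q * τ) * (1 - e) := by ring
    have h6 : |τ * (Real.sin q - q)| ≤ 2 * |q| ^ 3 := by
      rw [abs_mul]; nlinarith [abs_nonneg τ, abs_nonneg (Real.sin q - q)]
    have h7 : |Real.sin (q * τ) - q * τ| ≤ 2 * |q| ^ 3 :=
      h2.trans (by gcongr)
    have h8 : |Real.sin (q * τ) * (1 - e)| ≤ |q| ^ 3 / 2 := by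
      rw [abs_mul, abs_of_nonneg (by linarith : 0 ≤ 1 - e)]
      calc _ ≤ |q| * (q ^ 2 / 2) :=
            mul_le_mul (Real.abs_sin_le_abs.trans h3) h4 (by linarith) (abs_nonneg _)
        _ = _ := by rw [← sq_abs]; ring
    rw [h5]
    have h9 := abs_add_le (τ * (Real.sin q - q) + -(Real.sin (q * τ) - q * τ))
      (Real.sin (q * τ) * (1 - e))
    have h10 := abs_add_le (τ * (Real.sin q - q)) (-(Real.sin (q * τ) - q * τ))
    rw [abs_neg] at h10
    have h11 : 0 ≤ |q| ^ 3 := by positivity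
    linarith
  refine (norm_add_le _ _).trans ?_
  rw [norm_mul, Complex.norm_I, mul_one, Complex.norm_real, Complex.norm_real, Real.norm_eq_abs,
    Real.norm_eq_abs]
  have h1 : q ^ 2 * τ ^ 2 ≤ u ^ 2 * s ^ 2 * x ^ 4 := by
    calc _ ≤ q ^ 2 * (s * x) ^ 2 := by gcongr
      _ = _ := by rw [hq]; ring
  have h2 : |q| ^ 3 = |u| ^ 3 * |x| ^ 3 := by rw [hq, abs_mul, mul_pow]
  have h3 : q ^ 4 = u ^ 4 * x ^ 4 := by rw [hq, mul_pow]
  rw [h3] at hre; rw [h2] at him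
  linarith

/-- Telescoping: exchanging one factor at a time costs its own difference, as all other factors have
norm at most `1`. -/
lemma norm_prod_sub_prod_le {ι : Type*} (S : Finset ι) (a b : ι → ℂ) (ha : ∀ i ∈ S, ‖a i‖ ≤ 1)
    (hb : ∀ i ∈ S, ‖b i‖ ≤ 1) :
    ‖∏ i ∈ S, a i - ∏ i ∈ S, b i‖ ≤ ∑ i ∈ S, ‖a i - b i‖ := by
  classical
  induction S using Finset.induction_on with
  | empty => simp
  | insert j S hj ih =>
    rw [Finset.prod_insert hj, Finset.prod_insert hj, Finset.sum_insert hj]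
    have h1 : a j * ∏ i ∈ S, a i - b j * ∏ i ∈ S, b i =
        (a j - b j) * ∏ i ∈ S, a i + b j * (∏ i ∈ S, a i - ∏ i ∈ S, b i) := by ring
    rw [h1]
    refine (norm_add_le _ _).trans (add_le_add ?_ ?_)
    · rw [norm_mul]
      refine mul_le_of_le_one_right (norm_nonneg _) ?_
      rw [norm_prod]
      exact Finset.prod_le_one (fun _ _ => norm_nonneg _)
        fun i hi => ha i (Finset.mem_insert_of_mem hi)
    · rw [norm_mul]
      refine (mul_le_of_le_one_left (norm_nonneg _) (hb j (Finset.mem_insert_self _ _))).trans ?_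
      exact ih (fun i hi => ha i (Finset.mem_insert_of_mem hi))
        fun i hi => hb i (Finset.mem_insert_of_mem hi)

lemma norm_prod_tiltFactor_sub_le {n : ℕ} (x : Fin n → ℝ) {s u D : ℝ}
    (hD : ∑ i, x i ^ 4 ≤ D * ∑ i, x i ^ 2) :
    ‖∏ i, tiltFactor (x i) s u - Complex.exp (-(u ^ 2 * (∑ i, x i ^ 2) / 2 : ℝ))‖ ≤
      (2 * u ^ 4 * D + 5 * |u| ^ 3 * (1 + D) + u ^ 2 * s ^ 2 * D) * ∑ i, x i ^ 2 := by
  have h1 : Complex.exp (-(u ^ 2 * (∑ i, x i ^ 2) / 2 : ℝ)) =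
      ∏ i, Complex.exp (-(u ^ 2 * x i ^ 2 / 2 : ℝ)) := by
    rw [← Complex.exp_sum]; congr 1
    push_cast
    rw [Finset.mul_sum, Finset.sum_div, Finset.sum_neg_distrib]
  rw [h1]
  refine (norm_prod_sub_prod_le _ _ _ (fun i _ => norm_tiltFactor_le_one _ _ _) fun i _ => ?_).trans
    ((Finset.sum_le_sum fun i _ => norm_tiltFactor_sub_exp_le (x i) s u).trans ?_)
  · rw [← Complex.ofReal_neg, Complex.norm_exp_ofReal, Real.exp_le_one_iff]
    have := mul_nonneg (sq_nonneg u) (sq_nonneg (x i)); linarith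
  -- `|x|³ ≤ x² + x⁴` reduces third powers to the two sums under control.
  have h3 : ∑ i, |x i| ^ 3 ≤ (1 + D) * ∑ i, x i ^ 2 := by
    calc ∑ i, |x i| ^ 3 ≤ ∑ i, (x i ^ 2 + x i ^ 4) := by
          refine Finset.sum_le_sum fun i _ => ?_
          have h2 : x i ^ 2 = |x i| ^ 2 := (sq_abs _).symm
          have h4 : x i ^ 4 = |x i| ^ 4 := by
            rw [← abs_pow, abs_of_nonneg (by positivity)]
          rw [h2, h4]
          nlinarith [mul_nonneg (sq_nonneg |x i|) (sq_nonneg (|x i| - 1 / 2)),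
            sq_nonneg |x i|, sq_nonneg (x i ^ 2)]
      _ ≤ _ := by rw [Finset.sum_add_distrib]; linarith
  rw [Finset.sum_add_distrib, Finset.sum_add_distrib, ← Finset.mul_sum, ← Finset.mul_sum,
    ← Finset.mul_sum]
  have h4 : 2 * u ^ 4 * ∑ i, x i ^ 4 ≤ 2 * u ^ 4 * (D * ∑ i, x i ^ 2) := by gcongr
  have h5 : 5 * |u| ^ 3 * ∑ i, |x i| ^ 3 ≤ 5 * |u| ^ 3 * ((1 + D) * ∑ i, x i ^ 2) := by gcongr
  have h6 : u ^ 2 * s ^ 2 * ∑ i, x i ^ 4 ≤ u ^ 2 * s ^ 2 * (D * ∑ i, x i ^ 2) := by gcongr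
  linarith

/-! ### A positive kernel with compactly supported Fourier transform -/

/-- The kernel `sinc²(y/2) + sinc²((y+π)/2)`. -/
def kern (y : ℝ) : ℝ := Real.sinc (y / 2) ^ 2 + Real.sinc ((y + Real.pi) / 2) ^ 2

/-- The Fourier transform of `kern`, supported in `[-1, 1]`. -/
def kernWeight (u : ℝ) : ℂ := (1 - |u| : ℝ) * (1 + Complex.exp ((u * Real.pi : ℝ) * Complex.I))

lemma continuous_kern : Continuous kern := by
  unfold kern
  have := Real.continuous_sinc
  fun_prop

lemma continuous_kernWeight : Continuous kernWeight := by
  unfold kernWeight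
  fun_prop

lemma sinc_half_sq_mul (y : ℝ) : Real.sinc (y / 2) ^ 2 * y ^ 2 = 2 * (1 - Real.cos y) := by
  rcases eq_or_ne y 0 with rfl | hy
  · simp
  rw [Real.sinc_of_ne_zero (by positivity)]
  have h := Real.cos_two_mul (y / 2)
  rw [show 2 * (y / 2) = y by ring] at h
  rw [h, div_pow]
  field_simp
  nlinarith [Real.sin_sq_add_cos_sq (y / 2)]

lemma integral_triangle (y : ℝ) :
    ∫ u in (-1 : ℝ)..1, ((1 - |u| : ℝ) : ℂ) * Complex.exp ((u * y : ℝ) * Complex.I) =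
      ((Real.sinc (y / 2) ^ 2 : ℝ) : ℂ) := by
  have hcont : Continuous fun u : ℝ =>
      ((1 - |u| : ℝ) : ℂ) * Complex.exp ((u * y : ℝ) * Complex.I) := by fun_prop
  rw [← intervalIntegral.integral_add_adjacent_intervals (b := 0)
    (hcont.intervalIntegrable _ _) (hcont.intervalIntegrable _ _)]
  have hneg : ∫ u in (-1 : ℝ)..0, ((1 - |u| : ℝ) : ℂ) * Complex.exp ((u * y : ℝ) * Complex.I) =
      ∫ u in (0 : ℝ)..1, ((1 - |u| : ℝ) : ℂ) * Complex.exp ((-u * y : ℝ) * Complex.I) := by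
    have := intervalIntegral.integral_comp_neg (a := 0) (b := 1) fun u : ℝ =>
      ((1 - |u| : ℝ) : ℂ) * Complex.exp ((u * y : ℝ) * Complex.I)
    simp only [neg_zero, abs_neg] at this
    rw [this]
  have hcont' : Continuous fun u : ℝ =>
      ((1 - |u| : ℝ) : ℂ) * Complex.exp ((-u * y : ℝ) * Complex.I) := by fun_prop
  rw [hneg, ← intervalIntegral.integral_add
    (hcont'.intervalIntegrable _ _) (hcont.intervalIntegrable _ _)]
  have hre : ∫ u in (0 : ℝ)..1, (((1 - |u| : ℝ) : ℂ) * Complex.exp ((-u * y : ℝ) * Complex.I) +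
      ((1 - |u| : ℝ) : ℂ) * Complex.exp ((u * y : ℝ) * Complex.I)) =
      ∫ u in (0 : ℝ)..1, ((2 * (1 - u) * Real.cos (u * y) : ℝ) : ℂ) := by
    refine intervalIntegral.integral_congr fun u hu => ?_
    rw [Set.uIcc_of_le zero_le_one] at hu
    have h1 : |u| = u := abs_of_nonneg hu.1
    simp only [h1]
    rw [Complex.exp_mul_I, Complex.exp_mul_I]
    push_cast
    rw [show -(u : ℂ) * y = -(u * y) by ring, Complex.cos_neg, Complex.sin_neg]
    ring
  rw [hre, intervalIntegral.integral_ofReal]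
  congr 1
  rcases eq_or_ne y 0 with rfl | hy
  · simp only [mul_zero, Real.cos_zero, mul_one, zero_div, Real.sinc_zero, one_pow]
    have hd : ∀ u ∈ Set.uIcc (0 : ℝ) 1,
        HasDerivAt (fun u : ℝ => 2 * u - u ^ 2) (2 * (1 - u)) u := fun u _ => by
      refine (((hasDerivAt_id u).const_mul 2).sub ((hasDerivAt_id u).pow 2)).congr_deriv ?_
      simp; ring
    rw [intervalIntegral.integral_eq_sub_of_hasDerivAt hd
      ((by fun_prop : Continuous fun u : ℝ => 2 * (1 - u)).intervalIntegrable _ _)]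
    norm_num
  · have hd : ∀ u ∈ Set.uIcc (0 : ℝ) 1,
        HasDerivAt (fun u : ℝ => 2 * (1 - u) * Real.sin (u * y) / y -
          2 * Real.cos (u * y) / y ^ 2) (2 * (1 - u) * Real.cos (u * y)) u := fun u _ => by
      have hm : HasDerivAt (fun u : ℝ => u * y) y u := by
        simpa using (hasDerivAt_id u).mul_const y
      have h1 : HasDerivAt (fun u : ℝ => 2 * (1 - u)) (-2) u := by
        refine (((hasDerivAt_id u).const_sub 1).const_mul 2).congr_deriv ?_
        norm_num
      refine (((h1.mul hm.sin).div_const y).sub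
        ((hm.cos.const_mul 2).div_const (y ^ 2))).congr_deriv ?_
      field_simp
      ring
    rw [intervalIntegral.integral_eq_sub_of_hasDerivAt hd
      ((by fun_prop : Continuous fun u : ℝ =>
        2 * (1 - u) * Real.cos (u * y)).intervalIntegrable _ _)]
    have := sinc_half_sq_mul y
    simp only [sub_self, mul_zero, zero_mul, zero_div, zero_sub, one_mul, Real.cos_zero,
      Real.sin_zero, mul_one, sub_zero]
    field_simp
    linarith

/-- The shift by `π` in `y` becomes the factor `exp (i π u)` in frequency. -/
lemma integral_kernWeight (y : ℝ) :
    ∫ u in (-1 : ℝ)..1, kernWeight u * Complex.exp ((u * y : ℝ) * Complex.I) = (kern y : ℂ) := by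
  rw [kern, Complex.ofReal_add, ← integral_triangle y, ← integral_triangle (y + Real.pi),
    ← intervalIntegral.integral_add]
  · refine intervalIntegral.integral_congr fun u _ => ?_
    simp only [kernWeight]
    have : Complex.exp ((u * (y + Real.pi) : ℝ) * Complex.I) =
        Complex.exp ((u * y : ℝ) * Complex.I) * Complex.exp ((u * Real.pi : ℝ) * Complex.I) := by
      rw [← Complex.exp_add]; congr 1; push_cast; ring
    rw [this]; ring
  · exact (by fun_prop : Continuous fun u : ℝ => ((1 - |u| : ℝ) : ℂ) *
      Complex.exp ((u * y : ℝ) * Complex.I)).intervalIntegrable _ _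
  · exact (by fun_prop : Continuous fun u : ℝ => ((1 - |u| : ℝ) : ℂ) *
      Complex.exp ((u * (y + Real.pi) : ℝ) * Complex.I)).intervalIntegrable _ _

lemma kern_nonneg (y : ℝ) : 0 ≤ kern y := by unfold kern; positivity

lemma sinc_half_sq_le (y : ℝ) : Real.sinc (y / 2) ^ 2 ≤ 5 * (1 + y ^ 2)⁻¹ := by
  have h1 := sinc_half_sq_mul y
  have h2 : Real.sinc (y / 2) ^ 2 ≤ 1 := by
    rw [sq_le_one_iff_abs_le_one]; exact Real.abs_sinc_le_one _
  rw [← div_eq_mul_inv, le_div_iff₀ (by positivity)]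
  nlinarith [Real.neg_one_le_cos y]

lemma integrable_kern : Integrable kern := by
  have h1 : Integrable fun y : ℝ => Real.sinc (y / 2) ^ 2 := by
    refine (integrable_inv_one_add_sq.const_mul 5).mono' ?_ (ae_of_all _ fun y => ?_)
    · have := Real.continuous_sinc
      exact (by fun_prop : Continuous fun y : ℝ => Real.sinc (y / 2) ^ 2).aestronglyMeasurable
    · rw [Real.norm_of_nonneg (sq_nonneg _)]
      exact sinc_half_sq_le y
  exact h1.add (h1.comp_add_right Real.pi)

lemma kern_le_two (y : ℝ) : kern y ≤ 2 := by
  have h : ∀ z, Real.sinc z ^ 2 ≤ 1 := fun z => by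
    rw [sq_le_one_iff_abs_le_one]; exact Real.abs_sinc_le_one _
  have := h (y / 2); have := h ((y + Real.pi) / 2)
  unfold kern; linarith

/-- The kernel decays only quadratically. -/
lemma kern_ge (y : ℝ) : 4 / (|y| + Real.pi) ^ 2 ≤ kern y := by
  have h1 := sinc_half_sq_mul y
  have h2 := sinc_half_sq_mul (y + Real.pi)
  -- The cosines in `h1` and `h2` now have opposite signs, so the right-hand sides add up to `4`,
  -- independently of `y`.
  rw [Real.cos_add_pi] at h2
  have hp := Real.pi_pos
  have h3 : y ^ 2 ≤ (|y| + Real.pi) ^ 2 := by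
    rw [← sq_abs]; gcongr; linarith
  have h4 : (y + Real.pi) ^ 2 ≤ (|y| + Real.pi) ^ 2 := by
    rw [← sq_abs]; gcongr
    exact (abs_add_le _ _).trans (by rw [abs_of_pos hp])
  rw [div_le_iff₀ (by have := abs_nonneg y; positivity), kern]
  nlinarith [mul_le_mul_of_nonneg_left h3 (sq_nonneg (Real.sinc (y / 2))),
    mul_le_mul_of_nonneg_left h4 (sq_nonneg (Real.sinc ((y + Real.pi) / 2)))]

/-- The shift keeps the zeros of the two `sinc²` terms apart. Strict positivity is what allows test
functions to be divided by `kern`. -/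
lemma kern_pos (y : ℝ) : 0 < kern y :=
  lt_of_lt_of_le (by have := abs_nonneg y; have := Real.pi_pos; positivity) (kern_ge y)

/-- Makes `exp (-|y|)` admissible in `Regime.tendsto_integral_tiltLaw`, with constant `16`; any
function decaying faster than quadratically would do. -/
lemma exp_neg_abs_div_kern_le (y : ℝ) : Real.exp (-|y|) / kern y ≤ 16 := by
  have hp := Real.pi_pos
  have h0 := abs_nonneg y
  rw [div_le_iff₀ (kern_pos y)]
  have h1 := kern_ge y
  have h3 : (|y| + Real.pi) ^ 2 ≤ 64 * Real.exp |y| := by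
    have := Real.quadratic_le_exp_of_nonneg h0
    have := Real.pi_lt_four
    nlinarith
  have h4 : Real.exp (-|y|) ≤ 16 * (4 / (|y| + Real.pi) ^ 2) := by
    rw [Real.exp_neg, inv_eq_one_div, ← mul_div_assoc, div_le_div_iff₀ (Real.exp_pos _)
      (by positivity)]
    linarith
  linarith

lemma norm_kernWeight_le {u : ℝ} (hu : |u| ≤ 1) : ‖kernWeight u‖ ≤ 2 := by
  rw [kernWeight, norm_mul, Complex.norm_real, Real.norm_eq_abs,
    abs_of_nonneg (by linarith : 0 ≤ 1 - |u|)]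
  have h2 : ‖(1 : ℂ) + Complex.exp ((u * Real.pi : ℝ) * Complex.I)‖ ≤ 2 := by
    refine (norm_add_le _ _).trans ?_
    rw [Complex.norm_exp_ofReal_mul_I, norm_one]; norm_num
  nlinarith [abs_nonneg u, norm_nonneg ((1 : ℂ) + Complex.exp ((u * Real.pi : ℝ) * Complex.I))]

/-- Integrals against `kern` are integrals of the characteristic function over `[-1, 1]`. -/
lemma integral_kern_mul_cexp (ν : Measure ℝ) [IsFiniteMeasure ν] (v : ℝ) :
    ∫ y, (kern y : ℂ) * Complex.exp ((v * y : ℝ) * Complex.I) ∂ν =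
      ∫ u in (-1 : ℝ)..1, kernWeight u * charFun ν (u + v) := by
  have h1 : ∀ y : ℝ, (kern y : ℂ) * Complex.exp ((v * y : ℝ) * Complex.I) =
      ∫ u in (-1 : ℝ)..1, kernWeight u * Complex.exp (((u + v) * y : ℝ) * Complex.I) := by
    intro y
    rw [← integral_kernWeight, ← intervalIntegral.integral_mul_const]
    refine intervalIntegral.integral_congr fun u _ => ?_
    simp only [mul_assoc]
    rw [← Complex.exp_add]; congr 2; push_cast; ring
  simp_rw [h1, charFun_apply_real, intervalIntegral.integral_of_le (by norm_num : (-1 : ℝ) ≤ 1)]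
  rw [integral_integral_swap]
  · refine integral_congr_ae (ae_of_all _ fun u => ?_)
    simp only
    rw [integral_const_mul]
    congr 2
    ext y; push_cast; rfl
  · have hc : Continuous (Function.uncurry fun (y u : ℝ) =>
        kernWeight u * Complex.exp (((u + v) * y : ℝ) * Complex.I)) := by
      have := continuous_kernWeight
      fun_prop
    have : IsFiniteMeasure (volume.restrict (Set.Ioc (-1 : ℝ) 1)) := ⟨by simp⟩
    refine (integrable_const (2 : ℝ)).mono' hc.aestronglyMeasurable ?_
    rw [ae_iff]
    refine measure_mono_null (t := Set.univ ×ˢ (Set.Ioc (-1 : ℝ) 1)ᶜ) ?_ ?_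
    · rintro ⟨y, u⟩ h
      simp only [Set.mem_prod, Set.mem_univ, true_and, Set.mem_compl_iff]
      intro hu
      apply h
      simp only [Function.uncurry]
      rw [norm_mul, Complex.norm_exp_ofReal_mul_I, mul_one]
      exact norm_kernWeight_le (abs_le.2 ⟨hu.1.le, hu.2⟩)
    · rw [Measure.prod_prod, Measure.restrict_apply measurableSet_Ioc.compl]
      simp

/-! ### Limit theorems for tilted sums of sign-flipped numbers -/

/-- Lévy's continuity theorem for finite measures. -/
lemma tendsto_finiteMeasure_of_tendsto_charFun {μs : ℕ → FiniteMeasure ℝ} {μ : FiniteMeasure ℝ}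
    (hμ : μ ≠ 0)
    (h : ∀ t : ℝ, Tendsto (fun k => charFun (μs k : Measure ℝ) t) atTop
      (𝓝 (charFun (μ : Measure ℝ) t))) :
    Tendsto μs atTop (𝓝 μ) := by
  -- The characteristic function at `0` is the total mass. So masses converge, and Lévy's theorem
  -- applies to the normalised measures.
  have hch : ∀ ν : FiniteMeasure ℝ, charFun (ν : Measure ℝ) 0 = (ν.mass : ℂ) := fun ν => by
    rw [charFun_zero]; simp
  have hmassC : Tendsto (fun k => ((μs k).mass : ℂ)) atTop (𝓝 (μ.mass : ℂ)) := by
    simpa only [hch] using h 0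
  have hmass : Tendsto (fun k => (μs k).mass) atTop (𝓝 μ.mass) := by
    rw [← NNReal.tendsto_coe]
    exact (Complex.continuous_re.tendsto _).comp hmassC
  have hne : ∀ᶠ k in atTop, μs k ≠ 0 := by
    filter_upwards [hmass.eventually_ne ((FiniteMeasure.mass_nonzero_iff μ).2 hμ)] with k hk
    exact (FiniteMeasure.mass_nonzero_iff _).1 hk
  have hnorm : ∀ ν : FiniteMeasure ℝ, ν ≠ 0 → ∀ t : ℝ,
      charFun (ν.normalize : Measure ℝ) t = (ν.mass : ℂ)⁻¹ * charFun (ν : Measure ℝ) t := by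
    intro ν hν t
    rw [FiniteMeasure.toMeasure_normalize_eq_of_nonzero ν hν, charFun_apply, charFun_apply,
      integral_smul_nnreal_measure, NNReal.smul_def, Complex.real_smul]
    push_cast; rfl
  refine FiniteMeasure.tendsto_of_tendsto_normalize_testAgainstNN_of_tendsto_mass ?_ hmass
  refine ProbabilityMeasure.tendsto_of_tendsto_charFun fun t => ?_
  rw [hnorm μ hμ]
  have hm0 : (μ.mass : ℂ) ≠ 0 := by
    exact_mod_cast (FiniteMeasure.mass_nonzero_iff μ).2 hμ
  refine Tendsto.congr' ?_ ((hmassC.inv₀ hm0).mul (h t))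
  filter_upwards [hne] with k hk
  rw [hnorm _ hk]

/-- Triangular arrays of numbers with diverging sum of squares, comparable sum of fourth powers,
and vanishing tilt. -/
structure Regime (n : ℕ → ℕ) (x : ∀ k, Fin (n k) → ℝ) (s : ℕ → ℝ) (D : ℝ) : Prop where
  tendsto_sum_sq : Tendsto (fun k => ∑ i, x k i ^ 2) atTop atTop
  sum_pow_four_le : ∀ k, ∑ i, x k i ^ 4 ≤ D * ∑ i, x k i ^ 2
  tendsto_tilt : Tendsto s atTop (𝓝 0)

section

variable {n : ℕ → ℕ} {x : ∀ k, Fin (n k) → ℝ} {s : ℕ → ℝ} {D : ℝ}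

lemma Regime.nonneg (h : Regime n x s D) : 0 ≤ D := by
  obtain ⟨k, hk⟩ := (h.tendsto_sum_sq.eventually_gt_atTop 0).exists
  by_contra hD
  have h1 := h.sum_pow_four_le k
  have h2 : 0 ≤ ∑ i, x k i ^ 4 := Finset.sum_nonneg fun i _ => by positivity
  nlinarith [mul_pos (neg_pos.2 (not_le.1 hD)) hk]

lemma Regime.tendsto_sqrt (h : Regime n x s D) :
    Tendsto (fun k => √(∑ i, x k i ^ 2)) atTop atTop :=
  Real.tendsto_sqrt_atTop.comp h.tendsto_sum_sq

/-- At `u = t / √B`, the three error terms of `norm_prod_tiltFactor_sub_le` are of order `B⁻¹`,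
`B^(-1/2)` and `s²`. -/
lemma Regime.tendsto_prod_tiltFactor (h : Regime n x s D) (t : ℝ) :
    Tendsto (fun k => ∏ i, tiltFactor (x k i) (s k) (t / √(∑ i, x k i ^ 2))) atTop
      (𝓝 (Complex.exp (-(t ^ 2 / 2 : ℝ)))) := by
  rw [tendsto_iff_norm_sub_tendsto_zero]
  have hR := h.tendsto_sqrt.inv_tendsto_atTop
  have hlim : Tendsto (fun k => 2 * t ^ 4 * D * ((√(∑ i, x k i ^ 2))⁻¹) ^ 2 +
      5 * |t| ^ 3 * (1 + D) * (√(∑ i, x k i ^ 2))⁻¹ + t ^ 2 * (s k) ^ 2 * D) atTop (𝓝 0) := by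
    have := (((hR.pow 2).const_mul (2 * t ^ 4 * D)).add
      (hR.const_mul (5 * |t| ^ 3 * (1 + D)))).add
        (((h.tendsto_tilt.pow 2).const_mul (t ^ 2)).mul_const D)
    simpa using this
  refine squeeze_zero' (Eventually.of_forall fun k => norm_nonneg _) ?_ hlim
  filter_upwards [h.tendsto_sum_sq.eventually_gt_atTop 0] with k hk
  have hb := norm_prod_tiltFactor_sub_le (x k) (s := s k) (u := t / √(∑ i, x k i ^ 2))
    (h.sum_pow_four_le k)
  set R := √(∑ i, x k i ^ 2) with hRdef
  have hR0 : 0 < R := Real.sqrt_pos.2 hk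
  have hB : ∑ i, x k i ^ 2 = R ^ 2 := (Real.sq_sqrt hk.le).symm
  have e1 : (t / R) ^ 2 * (∑ i, x k i ^ 2) / 2 = t ^ 2 / 2 := by
    rw [hB]; field_simp
  rw [e1] at hb
  refine hb.trans (le_of_eq ?_)
  rw [hB, abs_div, abs_of_pos hR0]
  field_simp

lemma gaussianReal_real_Ici (z : ℝ) :
    (gaussianReal 0 1).real (Set.Ici z) = 1 - stdNormalCDF z := by
  have := nullSingletonClass_gaussianReal (μ := 0) (one_ne_zero : (1 : NNReal) ≠ 0)
  rw [stdNormalCDF, cdf_eq_real, ← probReal_compl_eq_one_sub measurableSet_Iic, Set.compl_Iic]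
  exact measureReal_congr Ioi_ae_eq_Ici.symm

/-- The central limit theorem for tilted sums. -/
lemma Regime.tendsto_tiltLaw_Ici (h : Regime n x s D) (z : ℝ) :
    Tendsto (fun k => (tiltLaw (x k) (s k) (√(∑ i, x k i ^ 2))⁻¹).real (Set.Ici z)) atTop
      (𝓝 (1 - stdNormalCDF z)) := by
  let ν : ℕ → ProbabilityMeasure ℝ := fun k =>
    ⟨tiltLaw (x k) (s k) (√(∑ i, x k i ^ 2))⁻¹, inferInstance⟩
  let γ : ProbabilityMeasure ℝ := ⟨gaussianReal 0 1, inferInstance⟩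
  have hν : Tendsto ν atTop (𝓝 γ) := by
    refine ProbabilityMeasure.tendsto_of_tendsto_charFun fun t => ?_
    have h1 := h.tendsto_prod_tiltFactor t
    simp only [ν, γ, ProbabilityMeasure.coe_mk, charFun_tiltLaw, ← div_eq_mul_inv,
      charFun_gaussianReal]
    convert! h1 using 3
    simp
  have := nullSingletonClass_gaussianReal (μ := 0) (one_ne_zero : (1 : NNReal) ≠ 0)
  have hfr : (γ : Measure ℝ) (frontier (Set.Ici z)) = 0 := by
    rw [frontier_Ici]
    change gaussianReal 0 1 {z} = 0
    exact measure_singleton z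
  have := ProbabilityMeasure.tendsto_measure_of_null_frontier_of_tendsto' hν hfr
  rw [← gaussianReal_real_Ici]
  exact (ENNReal.tendsto_toReal (measure_ne_top _ _)).comp this

/-- At the scale `s √B`, tilted sums and Gaussians have asymptotically equal integrals of `kern`
against characters. -/
lemma Regime.tendsto_integral_kernWeight (h : Regime n x s D) (hs : ∀ k, 0 < s k)
    (hL : Tendsto (fun k => s k * √(∑ i, x k i ^ 2)) atTop atTop) (v : ℝ) :
    Tendsto (fun k => (s k * √(∑ i, x k i ^ 2) : ℝ) * ∫ u in (-1 : ℝ)..1, kernWeight u *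
      ((∏ i, tiltFactor (x k i) (s k) ((u + v) * s k)) -
        Complex.exp (-((s k * √(∑ i, x k i ^ 2) * (u + v)) ^ 2 / 2 : ℝ)))) atTop (𝓝 0) := by
  set R : ℕ → ℝ := fun k => √(∑ i, x k i ^ 2) with hR
  set L : ℕ → ℝ := fun k => s k * R k with hLdef
  -- Substituting `t = L (u + v)` absorbs the prefactor `L` and turns the frequency `(u + v) s` into
  -- `t / √B`. There the integrand tends to `0` pointwise and is dominated by a Gaussian.
  set F : ℕ → ℝ → ℂ := fun k => (Set.Ioc (L k * (v - 1)) (L k * (v + 1))).indicator fun t =>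
    kernWeight (t / L k - v) * ((∏ i, tiltFactor (x k i) (s k) (t / R k)) -
      Complex.exp (-(t ^ 2 / 2 : ℝ))) with hF
  -- The frequency is `s (t / L)` with `|t / L| ≤ 1 + |v|` on the support, so the last condition is
  -- the smallness that `norm_prod_tiltFactor_le` requires.
  have hev : ∀ᶠ k in atTop, 0 < L k ∧ 0 < R k ∧
      D * ((s k) ^ 2 * ((1 + |v|) ^ 2 + 1)) ≤ 1 / 2 := by
    have h1 : Tendsto (fun k => D * ((s k) ^ 2 * ((1 + |v|) ^ 2 + 1))) atTop (𝓝 0) := by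
      simpa using ((h.tendsto_tilt.pow 2).mul_const ((1 + |v|) ^ 2 + 1)).const_mul D
    filter_upwards [hL.eventually_gt_atTop 0, h.tendsto_sqrt.eventually_gt_atTop 0,
      h1.eventually_lt_const (by norm_num : (0 : ℝ) < 1 / 2)] with k h1 h2 h3
    exact ⟨h1, h2, h3.le⟩
  have hmem : ∀ k t, 0 < L k → t ∈ Set.Ioc (L k * (v - 1)) (L k * (v + 1)) →
      |t / L k - v| ≤ 1 := by
    intro k t hk ht
    have h1 : v - 1 < t / L k := by rw [lt_div_iff₀ hk]; linarith [ht.1]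
    have h2 : t / L k ≤ v + 1 := by rw [div_le_iff₀ hk]; linarith [ht.2]
    rw [abs_le]; constructor <;> linarith
  have hF0 : Tendsto (fun k => ∫ t, F k t) atTop (𝓝 (∫ _ : ℝ, (0 : ℂ))) := by
    refine tendsto_integral_filter_of_dominated_convergence
      (fun t => 4 * Real.exp (-(1 / 4) * t ^ 2)) ?_ ?_ ?_ ?_
    · refine Eventually.of_forall fun k => ?_
      refine AEStronglyMeasurable.indicator ?_ measurableSet_Ioc
      refine Continuous.aestronglyMeasurable ?_
      have := continuous_kernWeight
      unfold tiltFactor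
      fun_prop
    · filter_upwards [hev] with k ⟨hL0, hR0, hk⟩
      refine ae_of_all _ fun t => ?_
      simp only [hF, Set.indicator]
      split_ifs with ht
      swap
      · simp; positivity
      rw [norm_mul]
      have h1 := norm_kernWeight_le (hmem k t hL0 ht)
      have hB : ∑ i, x k i ^ 2 = R k ^ 2 :=
        (Real.sq_sqrt (Finset.sum_nonneg fun i _ => sq_nonneg _)).symm
      have h2 : ‖∏ i, tiltFactor (x k i) (s k) (t / R k)‖ ≤ Real.exp (-(1 / 4) * t ^ 2) := by
        refine (norm_prod_tiltFactor_le (x k) (h.sum_pow_four_le k) ?_).trans (le_of_eq ?_)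
        · refine le_trans (mul_le_mul_of_nonneg_left ?_ h.nonneg) hk
          have h3 : t / R k = s k * (t / L k) := by
            have := (hs k).ne'
            simp only [hLdef]; field_simp
          have h4 : |t / L k| ≤ 1 + |v| := by
            have := hmem k t hL0 ht
            calc |t / L k| = |(t / L k - v) + v| := by ring_nf
              _ ≤ _ := (abs_add_le _ _).trans (by linarith)
          have h5 : (t / L k) ^ 2 ≤ (1 + |v|) ^ 2 := by
            rw [← sq_abs]; gcongr
          rw [h3, mul_pow]
          nlinarith [mul_le_mul_of_nonneg_left h5 (sq_nonneg (s k))]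
        · rw [hB]; congr 1; field_simp
      have h3 : ‖Complex.exp (-(t ^ 2 / 2 : ℝ))‖ ≤ Real.exp (-(1 / 4) * t ^ 2) := by
        rw [← Complex.ofReal_neg, Complex.norm_exp_ofReal, Real.exp_le_exp]
        nlinarith [sq_nonneg t]
      have h4 := (norm_sub_le (∏ i, tiltFactor (x k i) (s k) (t / R k))
        (Complex.exp (-(t ^ 2 / 2 : ℝ)))).trans (add_le_add h2 h3)
      calc _ ≤ 2 * (Real.exp (-(1 / 4) * t ^ 2) + Real.exp (-(1 / 4) * t ^ 2)) :=
            mul_le_mul h1 h4 (norm_nonneg _) (by norm_num)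
        _ = _ := by ring
    · exact (integrable_exp_neg_mul_sq (by norm_num)).const_mul 4
    · refine ae_of_all _ fun t => ?_
      have h1 := (tendsto_iff_norm_sub_tendsto_zero.1 (h.tendsto_prod_tiltFactor t)).const_mul 2
      rw [mul_zero] at h1
      rw [tendsto_zero_iff_norm_tendsto_zero]
      refine squeeze_zero' (Eventually.of_forall fun k => norm_nonneg _) ?_ h1
      filter_upwards [hev] with k ⟨hL0, hR0, hk⟩
      simp only [hF, Set.indicator]
      split_ifs with ht
      · rw [norm_mul]
        exact mul_le_mul_of_nonneg_right (norm_kernWeight_le (hmem k t hL0 ht)) (norm_nonneg _)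
      · simp
  rw [integral_zero] at hF0
  refine hF0.congr' ?_
  filter_upwards [hev] with k ⟨hL0, hR0, hk⟩
  simp only [hF]
  rw [integral_indicator measurableSet_Ioc, ← intervalIntegral.integral_of_le (by nlinarith)]
  have hsub := intervalIntegral.integral_comp_div_sub (a := L k * (v - 1)) (b := L k * (v + 1))
    (fun u => kernWeight u * ((∏ i, tiltFactor (x k i) (s k) ((u + v) * s k)) -
        Complex.exp (-((L k * (u + v)) ^ 2 / 2 : ℝ)))) hL0.ne' v
  have e1 : L k * (v - 1) / L k - v = -1 := by field_simp; ring
  have e2 : L k * (v + 1) / L k - v = 1 := by field_simp; ring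
  rw [e1, e2, Complex.real_smul] at hsub
  rw [← hsub]
  refine intervalIntegral.integral_congr fun t _ => ?_
  have e3 : (t / L k - v + v) * s k = t / R k := by
    have := (hs k).ne'
    simp only [hLdef, sub_add_cancel]; field_simp
  have e4 : L k * (t / L k - v + v) = t := by rw [sub_add_cancel]; field_simp
  simp only [e3, e4]

/-- Integrals of `kern` against characters under widening centred Gaussians. -/
lemma tendsto_integral_kernWeight_gaussian {L : ℕ → ℝ} (hL : Tendsto L atTop atTop) (v : ℝ) :
    Tendsto (fun k => (L k : ℂ) * ∫ u in (-1 : ℝ)..1, kernWeight u *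
        Complex.exp (-((L k * (u + v)) ^ 2 / 2 : ℝ))) atTop
      (𝓝 (∫ y, ((√(2 * Real.pi))⁻¹ * kern y : ℝ) * Complex.exp ((v * y : ℝ) * Complex.I))) := by
  have hlim : Tendsto (fun k => ∫ y, (((√(2 * Real.pi))⁻¹ * kern y *
        Real.exp (-(y ^ 2 / 2) * ((L k)⁻¹) ^ 2) : ℝ) : ℂ) *
        Complex.exp ((v * y : ℝ) * Complex.I)) atTop
      (𝓝 (∫ y, ((√(2 * Real.pi))⁻¹ * kern y : ℝ) *
        Complex.exp ((v * y : ℝ) * Complex.I))) := by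
    refine tendsto_integral_of_dominated_convergence (fun y => (√(2 * Real.pi))⁻¹ * kern y)
      (fun k => ?_) (integrable_kern.const_mul _) (fun k => ae_of_all _ fun y => ?_)
      (ae_of_all _ fun y => ?_)
    · have := continuous_kern
      exact Continuous.aestronglyMeasurable (by fun_prop)
    · have h0 : 0 ≤ (√(2 * Real.pi))⁻¹ * kern y := mul_nonneg (by positivity) (kern_nonneg y)
      rw [norm_mul, Complex.norm_exp_ofReal_mul_I, mul_one, Complex.norm_real, Real.norm_eq_abs,
        abs_of_nonneg (mul_nonneg h0 (Real.exp_pos _).le)]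
      refine mul_le_of_le_one_right h0 (Real.exp_le_one_iff.2 ?_)
      nlinarith [mul_nonneg (sq_nonneg y) (sq_nonneg (L k)⁻¹)]
    · refine Tendsto.mul_const _ ((Complex.continuous_ofReal.tendsto _).comp ?_)
      have h1 : Tendsto (fun k => Real.exp (-(y ^ 2 / 2) * ((L k)⁻¹) ^ 2)) atTop (𝓝 1) := by
        have := (hL.inv_tendsto_atTop.pow 2).const_mul (-(y ^ 2 / 2))
        simpa [Function.comp_def] using (Real.continuous_exp.tendsto _).comp this
      simpa using h1.const_mul ((√(2 * Real.pi))⁻¹ * kern y)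
  refine hlim.congr' ?_
  filter_upwards [hL.eventually_gt_atTop 0] with k hk
  -- The Gaussian factor is the characteristic function of `N(0, L²)`, whose density times `L` is
  -- `exp (-y² / (2 L²)) / √(2π)` and flattens to a constant.
  obtain ⟨w, hwr⟩ : ∃ w : NNReal, (w : ℝ) = L k ^ 2 :=
    ⟨(L k ^ 2).toNNReal, Real.coe_toNNReal _ (sq_nonneg _)⟩
  have hw0 : w ≠ 0 := fun h0 => by
    rw [h0] at hwr
    exact (pow_pos hk 2).ne hwr
  have hg := integral_kern_mul_cexp (gaussianReal 0 w) v
  have hch : ∀ u : ℝ, charFun (gaussianReal 0 w) (u + v) =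
      Complex.exp (-((L k * (u + v)) ^ 2 / 2 : ℝ)) := fun u => by
    rw [charFun_gaussianReal]
    congr 1
    have : ((w : ℝ) : ℂ) = (L k : ℂ) ^ 2 := by rw [hwr]; push_cast; rfl
    rw [this]; push_cast; ring
  simp only [hch] at hg
  rw [← hg, integral_gaussianReal_eq_integral_smul hw0, ← integral_const_mul]
  refine integral_congr_ae (ae_of_all _ fun y => ?_)
  simp only
  rw [Complex.real_smul, ← mul_assoc, ← mul_assoc, ← Complex.ofReal_mul, ← Complex.ofReal_mul]
  congr 2
  rw [gaussianPDFReal]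
  rw [hwr, Real.sqrt_mul (show 0 ≤ 2 * Real.pi by positivity) (L k ^ 2), Real.sqrt_sq hk.le,
    sub_zero]
  have : -y ^ 2 / (2 * L k ^ 2) = -(y ^ 2 / 2) * ((L k)⁻¹) ^ 2 := by
    field_simp
  rw [this]
  field_simp

end

/-! ### Local limit theorem and the Laplace functional on the half-line -/

section

variable {n : ℕ → ℕ} {x : ∀ k, Fin (n k) → ℝ} {s : ℕ → ℝ} {D : ℝ}

lemma integral_withDensity_ofReal {E : Type*} [NormedAddCommGroup E] [NormedSpace ℝ E]
    (ν : Measure ℝ) {f : ℝ → ℝ} (hf : Continuous f) (hf0 : ∀ y, 0 ≤ f y) (g : ℝ → E) :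
    ∫ y, g y ∂ν.withDensity (fun y => ENNReal.ofReal (f y)) = ∫ y, f y • g y ∂ν := by
  rw [integral_withDensity_eq_integral_toReal_smul hf.measurable.ennreal_ofReal
    (ae_of_all _ fun y => ENNReal.ofReal_lt_top)]
  simp_rw [ENNReal.toReal_ofReal (hf0 _)]

/-- The local limit theorem for tilted sums, at the scale `s √B`. -/
lemma Regime.tendsto_integral_tiltLaw (h : Regime n x s D) (hs : ∀ k, 0 < s k)
    (hL : Tendsto (fun k => s k * √(∑ i, x k i ^ 2)) atTop atTop) {F : ℝ → ℝ}
    (hF : Continuous F) {C : ℝ} (hFC : ∀ y, |F y| ≤ C * kern y) :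
    Tendsto (fun k => s k * √(∑ i, x k i ^ 2) * ∫ y, F y ∂tiltLaw (x k) (s k) (s k)) atTop
      (𝓝 ((√(2 * Real.pi))⁻¹ * ∫ y, F y)) := by
  set L : ℕ → ℝ := fun k => s k * √(∑ i, x k i ^ 2) with hLdef
  set c : ℝ := (√(2 * Real.pi))⁻¹ with hc
  have hc0 : 0 < c := by positivity
  have hL0 : ∀ k, 0 ≤ L k := fun k => mul_nonneg (hs k).le (Real.sqrt_nonneg _)
  have hcont : ∀ a : ℝ, Continuous fun y => a * kern y := fun a => continuous_kern.const_mul a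
  have hnn : ∀ a : ℝ, 0 ≤ a → ∀ y, 0 ≤ a * kern y := fun a ha y => mul_nonneg ha (kern_nonneg y)
  -- The laws multiplied by `L` approach a multiple of Lebesgue measure, which is infinite.
  -- Weighting by `kern` makes this weak convergence of finite measures, accessible to
  -- characteristic functions.
  have hfin : ∀ k, IsFiniteMeasure ((tiltLaw (x k) (s k) (s k)).withDensity
      fun y => ENNReal.ofReal (L k * kern y)) := fun k =>
    isFiniteMeasure_withDensity_ofReal ((Integrable.of_bound
      (hcont (L k)).aestronglyMeasurable (L k * 2) (ae_of_all _ fun y => by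
        rw [Real.norm_of_nonneg (hnn _ (hL0 k) y)]
        exact mul_le_mul_of_nonneg_left (kern_le_two y) (hL0 k))).2)
  have hfin' : IsFiniteMeasure ((volume : Measure ℝ).withDensity
      fun y => ENNReal.ofReal (c * kern y)) :=
    isFiniteMeasure_withDensity_ofReal (integrable_kern.const_mul c).2
  let μs : ℕ → FiniteMeasure ℝ := fun k => ⟨_, hfin k⟩
  let μ : FiniteMeasure ℝ := ⟨_, hfin'⟩
  have hμ : μ ≠ 0 := by
    intro h0
    have h1 : (volume : Measure ℝ).withDensity (fun y => ENNReal.ofReal (c * kern y)) = 0 :=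
      congrArg (fun ν : FiniteMeasure ℝ => (ν : Measure ℝ)) h0
    rw [withDensity_eq_zero_iff (hcont c).measurable.ennreal_ofReal.aemeasurable] at h1
    obtain ⟨y, hy⟩ := h1.exists
    simp only [Pi.zero_apply, ENNReal.ofReal_eq_zero] at hy
    exact absurd (mul_pos hc0 (kern_pos y)) (not_lt.2 hy)
  have hint : ∀ (E : Type) [NormedAddCommGroup E] [NormedSpace ℝ E] (g : ℝ → E) k,
      ∫ y, g y ∂(μs k : Measure ℝ) = ∫ y, (L k * kern y) • g y ∂tiltLaw (x k) (s k) (s k) :=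
    fun E _ _ g k => integral_withDensity_ofReal _ (hcont _) (hnn _ (hL0 k)) g
  have hint' : ∀ (E : Type) [NormedAddCommGroup E] [NormedSpace ℝ E] (g : ℝ → E),
      ∫ y, g y ∂(μ : Measure ℝ) = ∫ y, (c * kern y) • g y :=
    fun E _ _ g => integral_withDensity_ofReal _ (hcont _) (hnn _ hc0.le) g
  have hlim : Tendsto μs atTop (𝓝 μ) := by
    refine tendsto_finiteMeasure_of_tendsto_charFun hμ fun v => ?_
    have h1 := (h.tendsto_integral_kernWeight hs hL v).add
      (tendsto_integral_kernWeight_gaussian hL v)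
    rw [zero_add] at h1
    rw [charFun_apply_real, hint']
    have h2 : ∫ y, (c * kern y) • Complex.exp (v * y * Complex.I) =
        ∫ y, ((√(2 * Real.pi))⁻¹ * kern y : ℝ) * Complex.exp ((v * y : ℝ) * Complex.I) := by
      refine integral_congr_ae (ae_of_all _ fun y => ?_)
      simp only
      rw [Complex.real_smul, ← Complex.ofReal_mul]
    rw [h2]
    refine h1.congr fun k => ?_
    have hw := continuous_kernWeight
    have hc1 : Continuous fun u : ℝ => kernWeight u *
        ((∏ i, tiltFactor (x k i) (s k) ((u + v) * s k)) -
        Complex.exp (-((L k * (u + v)) ^ 2 / 2 : ℝ))) := by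
      unfold tiltFactor; fun_prop
    have hc2 : Continuous fun u : ℝ => kernWeight u *
        Complex.exp (-((L k * (u + v)) ^ 2 / 2 : ℝ)) := by fun_prop
    rw [charFun_apply_real, hint, ← mul_add, ← intervalIntegral.integral_add
      (hc1.intervalIntegrable _ _) (hc2.intervalIntegrable _ _)]
    have h3 := integral_kern_mul_cexp (tiltLaw (x k) (s k) (s k)) v
    simp only [charFun_tiltLaw] at h3
    have h4 : ∫ y, (L k * kern y) • Complex.exp (v * y * Complex.I) ∂tiltLaw (x k) (s k) (s k) =
        (L k : ℂ) * ∫ y, (kern y : ℂ) * Complex.exp ((v * y : ℝ) * Complex.I)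
          ∂tiltLaw (x k) (s k) (s k) := by
      rw [← integral_const_mul]
      refine integral_congr_ae (ae_of_all _ fun y => ?_)
      simp only
      rw [Complex.real_smul]; push_cast; ring
    rw [h4, h3]
    congr 1
    refine intervalIntegral.integral_congr fun u _ => ?_
    ring
  -- The weight is undone by testing against the bounded continuous function `F / kern`.
  have hfc : Continuous fun y => F y / kern y :=
    hF.div continuous_kern fun y => (kern_pos y).ne'
  have hfb : ∀ y, ‖F y / kern y‖ ≤ C := fun y => by
    rw [norm_div, Real.norm_eq_abs, Real.norm_of_nonneg (kern_nonneg y),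
      div_le_iff₀ (kern_pos y)]
    exact hFC y
  have hT := FiniteMeasure.tendsto_iff_forall_integral_tendsto.1 hlim
    (BoundedContinuousFunction.ofNormedAddCommGroup _ hfc C hfb)
  simp only [BoundedContinuousFunction.coe_ofNormedAddCommGroup, hint, hint', smul_eq_mul] at hT
  have hcan : ∀ a y : ℝ, a * kern y * (F y / kern y) = a * F y := fun a y => by
    have := (kern_pos y).ne'
    field_simp
  simpa only [hcan, integral_const_mul] using hT

/-- The Laplace functional of a tilted sum on the positive half-line. -/
def halfLaplace {m : ℕ} (x : Fin m → ℝ) (s : ℝ) : ℝ :=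
  ∫ y, (Set.Ici (0 : ℝ)).indicator (fun y => Real.exp (-y)) y ∂tiltLaw x s s

lemma integrable_exp_neg_abs : Integrable fun y : ℝ => Real.exp (-|y|) := by
  refine (integrable_kern.const_mul 16).mono' (by fun_prop) (ae_of_all _ fun y => ?_)
  rw [Real.norm_of_nonneg (Real.exp_pos _).le]
  exact (div_le_iff₀ (kern_pos y)).1 (exp_neg_abs_div_kern_le y)

/-- The continuous ramp from `0` at `a` to `1` at `a + ε`. -/
def ramp (a ε y : ℝ) : ℝ := max 0 (min 1 ((y - a) / ε))

lemma ramp_nonneg (a ε y : ℝ) : 0 ≤ ramp a ε y := le_max_left _ _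

lemma ramp_le_one (a ε y : ℝ) : ramp a ε y ≤ 1 := max_le zero_le_one (min_le_left _ _)

lemma continuous_ramp (a ε : ℝ) : Continuous (ramp a ε) := by unfold ramp; fun_prop

lemma ramp_of_le {a ε y : ℝ} (hε : 0 < ε) (hy : y ≤ a) : ramp a ε y = 0 :=
  max_eq_left ((min_le_right _ _).trans (div_nonpos_of_nonpos_of_nonneg (by linarith) hε.le))

lemma ramp_of_ge {a ε y : ℝ} (hε : 0 < ε) (hy : a + ε ≤ y) : ramp a ε y = 1 := by
  have : 1 ≤ (y - a) / ε := by rw [le_div_iff₀ hε]; linarith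
  rw [ramp, min_eq_left this, max_eq_right zero_le_one]

/-- The limit is `c ∫₀^∞ exp (-y) dy = c`. The integrand jumps at `0`, so it is squeezed between
continuous ramps ending or starting at `0`, each of which changes the integral by at most the width
`ε`. -/
lemma Regime.tendsto_halfLaplace (h : Regime n x s D) (hs : ∀ k, 0 < s k)
    (hL : Tendsto (fun k => s k * √(∑ i, x k i ^ 2)) atTop atTop) :
    Tendsto (fun k => s k * √(∑ i, x k i ^ 2) * halfLaplace (x k) (s k)) atTop
      (𝓝 (√(2 * Real.pi))⁻¹) := by
  set c : ℝ := (√(2 * Real.pi))⁻¹ with hc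
  have hc0 : 0 < c := by positivity
  have hramp : ∀ a ε : ℝ, Tendsto (fun k => s k * √(∑ i, x k i ^ 2) *
      ∫ y, ramp a ε y * Real.exp (-|y|) ∂tiltLaw (x k) (s k) (s k)) atTop
      (𝓝 (c * ∫ y, ramp a ε y * Real.exp (-|y|))) := fun a ε => by
    refine h.tendsto_integral_tiltLaw hs hL ?_ (C := 16) fun y => ?_
    · have := continuous_ramp a ε
      fun_prop
    · rw [abs_of_nonneg (mul_nonneg (ramp_nonneg _ _ _) (Real.exp_pos _).le)]
      refine (mul_le_of_le_one_left (Real.exp_pos _).le (ramp_le_one _ _ _)).trans ?_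
      exact (div_le_iff₀ (kern_pos y)).1 (exp_neg_abs_div_kern_le y)
  have hbdd : ∀ (ν : Measure ℝ) [IsFiniteMeasure ν] (a ε : ℝ),
      Integrable (fun y => ramp a ε y * Real.exp (-|y|)) ν := fun ν _ a ε => by
    refine Integrable.of_bound ?_ 1 (ae_of_all _ fun y => ?_)
    · have := continuous_ramp a ε
      exact Continuous.aestronglyMeasurable (by fun_prop)
    · rw [Real.norm_of_nonneg (mul_nonneg (ramp_nonneg _ _ _) (Real.exp_pos _).le)]
      exact mul_le_one₀ (ramp_le_one _ _ _) (Real.exp_pos _).le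
        (Real.exp_le_one_iff.2 (by linarith [abs_nonneg y]))
  have hvol : ∀ a ε : ℝ, Integrable fun y => ramp a ε y * Real.exp (-|y|) := fun a ε => by
    refine integrable_exp_neg_abs.mono' ?_ (ae_of_all _ fun y => ?_)
    · have := continuous_ramp a ε
      exact Continuous.aestronglyMeasurable (by fun_prop)
    · rw [Real.norm_of_nonneg (mul_nonneg (ramp_nonneg _ _ _) (Real.exp_pos _).le)]
      exact mul_le_of_le_one_left (Real.exp_pos _).le (ramp_le_one _ _ _)
  have hind : ∀ (ν : Measure ℝ) [IsFiniteMeasure ν],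
      Integrable ((Set.Ici (0 : ℝ)).indicator fun y => Real.exp (-y)) ν := fun ν _ => by
    refine Integrable.of_bound ((by fun_prop : Continuous fun y : ℝ =>
      Real.exp (-y)).aestronglyMeasurable.indicator measurableSet_Ici) 1 (ae_of_all _ fun y => ?_)
    simp only [Set.indicator]
    split_ifs with hy
    · rw [Real.norm_of_nonneg (Real.exp_pos _).le]
      exact Real.exp_le_one_iff.2 (by simpa using hy)
    · simp
  have hhalf : ∫ y, (Set.Ici (0 : ℝ)).indicator (fun y => Real.exp (-y)) y = 1 := by
    rw [integral_indicator measurableSet_Ici, integral_Ici_eq_integral_Ioi]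
    exact integral_exp_neg_Ioi_zero
  have hhalfi : Integrable ((Set.Ici (0 : ℝ)).indicator fun y => Real.exp (-y)) := by
    rw [integrable_indicator_iff measurableSet_Ici, integrableOn_Ici_iff_integrableOn_Ioi]
    exact integrableOn_exp_neg_Ioi 0
  have hboxi : ∀ a b : ℝ, Integrable ((Set.Icc a b).indicator fun _ => (1 : ℝ)) := fun a b => by
    rw [integrable_indicator_iff measurableSet_Icc]
    exact integrableOn_const (by simp)
  have hbox : ∀ a b : ℝ, a ≤ b → ∫ y, (Set.Icc a b).indicator (fun _ => (1 : ℝ)) y = b - a :=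
    fun a b hab => by
      rw [integral_indicator measurableSet_Icc]
      simp [hab]
  have hexp1 : ∀ y : ℝ, Real.exp (-|y|) ≤ 1 := fun y =>
    Real.exp_le_one_iff.2 (by linarith [abs_nonneg y])
  rw [tendsto_order]
  constructor
  · intro b hb
    obtain ⟨ε, hε, hε2⟩ : ∃ ε > 0, b < c * (1 - ε) := by
      refine ⟨(c - b) / (2 * c), by have := sub_pos.2 hb; positivity, ?_⟩
      field_simp; linarith
    have hlow : 1 - ε ≤ ∫ y, ramp 0 ε y * Real.exp (-|y|) := by
      have h1 : ∫ y, ((Set.Ici (0 : ℝ)).indicator (fun y => Real.exp (-y)) y -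
          (Set.Icc 0 ε).indicator (fun _ => (1 : ℝ)) y) ≤ ∫ y, ramp 0 ε y * Real.exp (-|y|) := by
        refine integral_mono (hhalfi.sub (hboxi 0 ε)) (hvol 0 ε) fun y => ?_
        have hr := mul_nonneg (ramp_nonneg 0 ε y) (Real.exp_pos (-|y|)).le
        have he := hexp1 y
        simp only [Set.indicator, Set.mem_Ici, Set.mem_Icc]
        rcases lt_or_ge y 0 with hy | hy
        · rw [if_neg (not_le.2 hy), if_neg (fun h => absurd h.1 (not_le.2 hy))]
          simpa using hr
        · rw [abs_of_nonneg hy] at hr he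
          rw [if_pos hy, abs_of_nonneg hy]
          rcases le_or_gt y ε with hy2 | hy2
          · rw [if_pos ⟨hy, hy2⟩]; linarith
          · rw [if_neg (fun h => absurd h.2 (not_le.2 hy2)), ramp_of_ge hε (by linarith)]
            simp
      rw [integral_sub hhalfi (hboxi 0 ε), hhalf, hbox 0 ε hε.le] at h1
      linarith
    have h2 := (hramp 0 ε).eventually_const_lt
      (hε2.trans_le (mul_le_mul_of_nonneg_left hlow hc0.le))
    filter_upwards [h2] with k hk
    refine hk.trans_le (mul_le_mul_of_nonneg_left ?_ (mul_nonneg (hs k).le (Real.sqrt_nonneg _)))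
    refine integral_mono (hbdd _ 0 ε) (hind _) fun y => ?_
    simp only [Set.indicator, Set.mem_Ici]
    split_ifs with hy
    · rw [abs_of_nonneg hy]
      exact mul_le_of_le_one_left (Real.exp_pos _).le (ramp_le_one _ _ _)
    · rw [ramp_of_le hε (not_le.1 hy).le, zero_mul]
  · intro b hb
    obtain ⟨ε, hε, hε2⟩ : ∃ ε > 0, c * (1 + ε) < b := by
      refine ⟨(b - c) / (2 * c), by have := sub_pos.2 hb; positivity, ?_⟩
      field_simp; linarith
    have hup : ∫ y, ramp (-ε) ε y * Real.exp (-|y|) ≤ 1 + ε := by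
      have h1 : ∫ y, ramp (-ε) ε y * Real.exp (-|y|) ≤
          ∫ y, ((Set.Ici (0 : ℝ)).indicator (fun y => Real.exp (-y)) y +
          (Set.Icc (-ε) 0).indicator (fun _ => (1 : ℝ)) y) := by
        refine integral_mono (hvol (-ε) ε) (hhalfi.add (hboxi (-ε) 0)) fun y => ?_
        have hr : ramp (-ε) ε y * Real.exp (-|y|) ≤ Real.exp (-|y|) :=
          mul_le_of_le_one_left (Real.exp_pos _).le (ramp_le_one _ _ _)
        have he := hexp1 y
        simp only [Set.indicator, Set.mem_Ici, Set.mem_Icc]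
        rcases lt_or_ge y 0 with hy | hy
        · rw [if_neg (not_le.2 hy)]
          rcases le_or_gt (-ε) y with hy2 | hy2
          · rw [if_pos ⟨hy2, hy.le⟩]; linarith
          · rw [ramp_of_le hε hy2.le, if_neg (fun h => absurd h.1 (not_le.2 hy2))]; simp
        · rw [abs_of_nonneg hy] at hr
          rw [if_pos hy, abs_of_nonneg hy]
          split_ifs <;> linarith
      rw [integral_add hhalfi (hboxi (-ε) 0), hhalf, hbox (-ε) 0 (by linarith)] at h1
      linarith
    have h2 := (hramp (-ε) ε).eventually_lt_const
      ((mul_le_mul_of_nonneg_left hup hc0.le).trans_lt hε2)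
    filter_upwards [h2] with k hk
    refine lt_of_le_of_lt (mul_le_mul_of_nonneg_left ?_
      (mul_nonneg (hs k).le (Real.sqrt_nonneg _))) hk
    refine integral_mono (hind _) (hbdd _ (-ε) ε) fun y => ?_
    simp only [Set.indicator, Set.mem_Ici]
    split_ifs with hy
    · rw [abs_of_nonneg hy, ramp_of_ge hε (by linarith), one_mul]
    · exact mul_nonneg (ramp_nonneg _ _ _) (Real.exp_pos _).le

end

/-! ### The standard normal distribution function -/

lemma stdNormalPDF_eq (t : ℝ) :
    stdNormalPDF t = (√(2 * Real.pi))⁻¹ * Real.exp (-(t ^ 2 / 2)) := by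
  rw [stdNormalPDF, gaussianPDFReal]
  simp [neg_div]

lemma continuous_stdNormalPDF : Continuous stdNormalPDF := by
  simp_rw [funext stdNormalPDF_eq]
  fun_prop

lemma hasDerivAt_stdNormalCDF (t : ℝ) : HasDerivAt stdNormalCDF (stdNormalPDF t) t := by
  have hi : Integrable stdNormalPDF := integrable_gaussianPDFReal 0 1
  have h1 : ∀ z, stdNormalCDF z = (∫ y in Set.Iic 0, stdNormalPDF y) +
      ∫ y in (0 : ℝ)..z, stdNormalPDF y := fun z => by
    rw [← intervalIntegral.integral_Iic_sub_Iic hi.integrableOn hi.integrableOn, stdNormalCDF,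
      cdf_eq_real, Measure.real, gaussianReal_apply_eq_integral 0 one_ne_zero,
      ENNReal.toReal_ofReal (integral_nonneg fun y => gaussianPDFReal_nonneg _ _ _)]
    simp only [stdNormalPDF]
    ring
  rw [funext h1]
  exact (intervalIntegral.integral_hasDerivAt_right (hi.intervalIntegrable)
    (continuous_stdNormalPDF.stronglyMeasurableAtFilter _ _)
    continuous_stdNormalPDF.continuousAt).const_add _

lemma continuous_stdNormalCDF : Continuous stdNormalCDF :=
  continuous_iff_continuousAt.2 fun t => (hasDerivAt_stdNormalCDF t).continuousAt

lemma stdNormalCDF_lt_one (t : ℝ) : stdNormalCDF t < 1 := by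
  have hm : StrictMono stdNormalCDF := strictMono_of_deriv_pos fun u => by
    rw [(hasDerivAt_stdNormalCDF u).deriv]
    exact gaussianPDFReal_pos _ _ _ one_ne_zero
  exact (hm (lt_add_one t)).trans_le (cdf_le_one _ _)

lemma stdNormalPDF_le_one (t : ℝ) : stdNormalPDF t ≤ 1 := by
  rw [stdNormalPDF_eq]
  refine mul_le_one₀ (inv_le_one_of_one_le₀ ?_) (Real.exp_pos _).le
    (Real.exp_le_one_iff.2 (by have := sq_nonneg t; linarith))
  rw [Real.one_le_sqrt]
  linarith [Real.pi_gt_three]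

/-- Mills' ratio. -/
lemma tendsto_mills :
    Tendsto (fun r : ℝ => r * Real.exp (r ^ 2 / 2) * (1 - stdNormalCDF r)) atTop
      (𝓝 (√(2 * Real.pi))⁻¹) := by
  set c : ℝ := (√(2 * Real.pi))⁻¹ with hc
  have hc0 : 0 < c := by positivity
  have hexp : ∀ r : ℝ, HasDerivAt (fun r : ℝ => Real.exp (-(r ^ 2 / 2)))
      (-r * Real.exp (-(r ^ 2 / 2))) r := fun r => by
    have h1 : HasDerivAt (fun r : ℝ => -(r ^ 2 / 2)) (-r) r := by
      refine (((hasDerivAt_id r).pow 2).div_const 2).neg.congr_deriv ?_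
      simp
    exact h1.exp.congr_deriv (by ring)
  have hinv0 : Tendsto (fun r : ℝ => r⁻¹) atTop (𝓝 0) := tendsto_inv_atTop_zero
  -- L'Hôpital against `exp (-r²/2) / r`: the derivatives have quotient `c / (1 + r⁻²)`.
  have hL : Tendsto (fun r : ℝ => (1 - stdNormalCDF r) / (Real.exp (-(r ^ 2 / 2)) * r⁻¹)) atTop
      (𝓝 c) := by
    refine HasDerivAt.lhopital_zero_atTop (f' := fun r => -stdNormalPDF r)
      (g' := fun r => -r * Real.exp (-(r ^ 2 / 2)) * r⁻¹ +
        Real.exp (-(r ^ 2 / 2)) * -(r ^ 2)⁻¹)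
      (Eventually.of_forall fun r => (hasDerivAt_stdNormalCDF r).const_sub 1) ?_ ?_ ?_ ?_ ?_
    · filter_upwards [eventually_gt_atTop 0] with r hr
      exact (hexp r).mul (hasDerivAt_inv hr.ne')
    · filter_upwards [eventually_gt_atTop 0] with r hr
      have he := Real.exp_pos (-(r ^ 2 / 2))
      have : -r * Real.exp (-(r ^ 2 / 2)) * r⁻¹ + Real.exp (-(r ^ 2 / 2)) * -(r ^ 2)⁻¹ =
          -(Real.exp (-(r ^ 2 / 2)) * (1 + (r ^ 2)⁻¹)) := by field_simp; ring
      rw [this]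
      exact neg_ne_zero.2 (by positivity)
    · simpa [stdNormalCDF] using (tendsto_cdf_atTop (gaussianReal 0 1)).const_sub 1
    · refine squeeze_zero' ?_ ?_ hinv0
      · filter_upwards [eventually_gt_atTop 0] with r hr
        positivity
      · filter_upwards [eventually_gt_atTop 0] with r hr
        exact mul_le_of_le_one_left (by positivity)
          (Real.exp_le_one_iff.2 (by have := sq_nonneg r; linarith))
    · have h1 : Tendsto (fun r : ℝ => c * (1 + (r⁻¹) ^ 2)⁻¹) atTop (𝓝 c) := by
        have := (((hinv0.pow 2).const_add 1).inv₀ (by norm_num)).const_mul c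
        simpa using this
      refine h1.congr' ?_
      filter_upwards [eventually_gt_atTop 0] with r hr
      have he := Real.exp_pos (-(r ^ 2 / 2))
      have h2 : -r * Real.exp (-(r ^ 2 / 2)) * r⁻¹ + Real.exp (-(r ^ 2 / 2)) * -(r ^ 2)⁻¹ =
          -(Real.exp (-(r ^ 2 / 2)) * (1 + (r ^ 2)⁻¹)) := by field_simp; ring
      rw [stdNormalPDF_eq, ← hc, h2, neg_div_neg_eq]
      field_simp
  refine hL.congr' ?_
  filter_upwards [eventually_gt_atTop 0] with r hr
  rw [Real.exp_neg]
  have he := Real.exp_pos (r ^ 2 / 2)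
  field_simp

/-! ### Sign-flipping p-values and the saddlepoint for fixed data -/

/-- The sign-flipping p-value of fixed data. -/
def flipProb {n : ℕ} (x : Fin n → ℝ) : ℝ :=
  ∑ σ, tiltWeight x 0 σ * if ∑ i, x i ≤ signSum x σ then 1 else 0

lemma flipProb_eq_tiltLaw {n : ℕ} (x : Fin n → ℝ) {ρ : ℝ} (hρ : 0 < ρ) :
    flipProb x = (tiltLaw x 0 ρ).real (Set.Ici (ρ * ∑ i, x i)) := by
  rw [← integral_indicator_one measurableSet_Ici, integral_tiltLaw, flipProb]
  refine Finset.sum_congr rfl fun σ _ => ?_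
  rw [tiltMean_zero, sub_zero, smul_eq_mul]
  simp only [Set.indicator, Set.mem_Ici, mul_le_mul_iff_right₀ hρ, Pi.one_apply]

/-- Exponential tilting of the sign-flipping p-value. -/
lemma flipProb_eq_halfLaplace {n : ℕ} (x : Fin n → ℝ) {s : ℝ} (hs : 0 < s)
    (hm : tiltMean x s = ∑ i, x i) :
    flipProb x = Real.exp (-∑ i, (s * x i - Real.log (Real.cosh (s * x i)))) *
      halfLaplace x s := by
  rw [halfLaplace, integral_tiltLaw, flipProb, Finset.mul_sum]
  refine Finset.sum_congr rfl fun σ _ => ?_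
  rw [hm]
  have hmem : s * (signSum x σ - ∑ i, x i) ∈ Set.Ici (0 : ℝ) ↔ ∑ i, x i ≤ signSum x σ := by
    rw [Set.mem_Ici, mul_nonneg_iff_of_pos_left hs, sub_nonneg]
  by_cases h : ∑ i, x i ≤ signSum x σ
  · rw [Set.indicator_of_mem (hmem.2 h), if_pos h, mul_one, smul_eq_mul]
    -- Change of measure: the tilted weights have density `exp (s S) / ∏ cosh (s xᵢ)` with respect
    -- to the uniform ones, `S` being the signed sum.
    have hw : tiltWeight x s σ = tiltWeight x 0 σ * Real.exp (s * signSum x σ) *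
        Real.exp (-∑ i, Real.log (Real.cosh (s * x i))) := by
      rw [← Finset.sum_neg_distrib, Real.exp_sum, signSum, Finset.mul_sum, Real.exp_sum, tiltWeight,
        tiltWeight, ← Finset.prod_mul_distrib, ← Finset.prod_mul_distrib]
      refine Finset.prod_congr rfl fun i _ => ?_
      have := Real.cosh_pos (s * x i)
      rw [Real.exp_neg, Real.exp_log this]
      simp
      field_simp
    rw [hw, Finset.sum_sub_distrib, ← Finset.mul_sum]
    have : Real.exp (-(s * ∑ i, x i - ∑ i, Real.log (Real.cosh (s * x i)))) *
        (tiltWeight x 0 σ * Real.exp (s * signSum x σ) *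
        Real.exp (-∑ i, Real.log (Real.cosh (s * x i))) *
        Real.exp (-(s * (signSum x σ - ∑ i, x i)))) = tiltWeight x 0 σ *
        (Real.exp (-(s * ∑ i, x i - ∑ i, Real.log (Real.cosh (s * x i)))) *
        Real.exp (s * signSum x σ) *
        Real.exp (-∑ i, Real.log (Real.cosh (s * x i))) *
        Real.exp (-(s * (signSum x σ - ∑ i, x i)))) := by ring
    rw [this, ← Real.exp_add, ← Real.exp_add, ← Real.exp_add]
    ring_nf
    simp
  · rw [Set.indicator_of_notMem (fun h' => h (hmem.1 h')), if_neg h]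
    simp

/-- As `1 / (1 + exp (2u)) = (1 - tanh u) / 2`, the saddlepoint equation says that the tilted mean
equals the observed sum. -/
lemma mem_solutionSet_iff {n : ℕ} (x : Fin n → ℝ) (s : ℝ) :
    s ∈ solutionSet x ↔ s ∈ Set.Icc (-1 : ℝ) 1 ∧ tiltMean x s = ∑ i, x i := by
  rw [solutionSet, Set.mem_ofPred_eq]
  have h : ∑ i, x i / (1 + Real.exp (2 * s * x i)) = (∑ i, x i - tiltMean x s) / 2 := by
    rw [tiltMean, ← Finset.sum_sub_distrib, Finset.sum_div]
    refine Finset.sum_congr rfl fun i _ => ?_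
    rw [mul_assoc, div_eq_mul_one_div, inv_one_add_exp_eq]
    ring
  rw [h]
  refine and_congr_right fun _ => ?_
  constructor <;> intro h' <;> linarith

/-- Every `y tanh (s y)` is monotone in `s`, strictly if `y ≠ 0`. Hence a solution is unique. -/
lemma strictMono_tiltMean {n : ℕ} (x : Fin n → ℝ) (hx : 0 < ∑ i, x i ^ 2) :
    StrictMono (tiltMean x) := by
  intro s t hst
  have hle : ∀ y : ℝ, y * Real.tanh (s * y) ≤ y * Real.tanh (t * y) := fun y => by
    rcases le_total 0 y with h | h
    · exact mul_le_mul_of_nonneg_left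
        (strictMono_tanh.monotone (mul_le_mul_of_nonneg_right hst.le h)) h
    · exact mul_le_mul_of_nonpos_left
        (strictMono_tanh.monotone (mul_le_mul_of_nonpos_right hst.le h)) h
  obtain ⟨i, -, hi⟩ := Finset.exists_ne_zero_of_sum_ne_zero hx.ne'
  have hi0 : x i ≠ 0 := fun h => hi (by rw [h]; simp)
  refine Finset.sum_lt_sum (fun i _ => hle (x i)) ⟨i, Finset.mem_univ _, ?_⟩
  rcases lt_or_gt_of_ne hi0 with h | h
  · exact mul_lt_mul_of_neg_left (strictMono_tanh (mul_lt_mul_of_neg_right hst h)) h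
  · exact mul_lt_mul_of_pos_left (strictMono_tanh (mul_lt_mul_of_pos_right hst h)) h

lemma continuous_tiltMean {n : ℕ} (x : Fin n → ℝ) : Continuous (tiltMean x) := by
  unfold tiltMean
  have := continuous_tanh
  fun_prop

lemma tiltMean_neg {n : ℕ} (x : Fin n → ℝ) (s : ℝ) : tiltMean x (-s) = -tiltMean x s := by
  simp [tiltMean]

lemma mul_tiltMean_bounds {n : ℕ} (x : Fin n → ℝ) (s : ℝ) :
    s ^ 2 * ∑ i, x i ^ 2 - s ^ 4 * ∑ i, x i ^ 4 ≤ s * tiltMean x s ∧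
      s * tiltMean x s ≤ s ^ 2 * ∑ i, x i ^ 2 := by
  rw [tiltMean, Finset.mul_sum, Finset.mul_sum, Finset.mul_sum, ← Finset.sum_sub_distrib]
  constructor
  · refine Finset.sum_le_sum fun i _ => ?_
    have h1 := mul_tanh_ge (s * x i)
    have h2 : 0 ≤ s ^ 4 * x i ^ 4 := by positivity
    nlinarith
  · refine Finset.sum_le_sum fun i _ => ?_
    have h1 := mul_tanh_le (s * x i)
    nlinarith

/-- Small means force a solution of the saddlepoint equation near the origin. -/
lemma exists_tiltMean_eq {n : ℕ} (x : Fin n → ℝ) {D δ : ℝ} (hδ : 0 < δ)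
    (hD : ∑ i, x i ^ 4 ≤ D * ∑ i, x i ^ 2) (hDδ : D * δ ^ 2 ≤ 1 / 2)
    (hm : |∑ i, x i| ≤ δ / 2 * ∑ i, x i ^ 2) :
    ∃ s, |s| ≤ δ ∧ tiltMean x s = ∑ i, x i := by
  have h1 := (mul_tiltMean_bounds x δ).1
  have hB0 : 0 ≤ ∑ i, x i ^ 2 := Finset.sum_nonneg fun i _ => sq_nonneg _
  -- `δ · tiltMean x δ ≥ δ² B - δ⁴ D B ≥ δ² B / 2`. By oddness the values at `±δ` enclose `∑ xᵢ`,
  -- and the intermediate value theorem applies.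
  have h2 : δ / 2 * ∑ i, x i ^ 2 ≤ tiltMean x δ := by
    refine le_of_mul_le_mul_left ?_ hδ
    refine le_trans ?_ h1
    have h3 := mul_le_mul_of_nonneg_left hD (by positivity : 0 ≤ δ ^ 4)
    nlinarith [mul_le_mul_of_nonneg_right hDδ (mul_nonneg (sq_nonneg δ) hB0)]
  rw [abs_le] at hm
  have hsub := intermediate_value_Icc (by linarith : -δ ≤ δ) (continuous_tiltMean x).continuousOn
  obtain ⟨s, hs, hs'⟩ := hsub (show ∑ i, x i ∈ Set.Icc (tiltMean x (-δ)) (tiltMean x δ) by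
    rw [tiltMean_neg]; constructor <;> linarith)
  exact ⟨s, abs_le.2 hs, hs'⟩

lemma existsUnique_and_saddlepoint {n : ℕ} (x : Fin n → ℝ) {s : ℝ} (hx : 0 < ∑ i, x i ^ 2)
    (hs : |s| ≤ 1) (hm : tiltMean x s = ∑ i, x i) :
    (∃! s, s ∈ solutionSet x) ∧ saddlepoint x = s := by
  have huniq : ∀ t, t ∈ solutionSet x → t = s := fun t ht =>
    (strictMono_tiltMean x hx).injective
      (((mem_solutionSet_iff x t).1 ht).2.trans hm.symm)
  have hex : ∃! s, s ∈ solutionSet x :=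
    ⟨s, (mem_solutionSet_iff x s).2 ⟨abs_le.1 hs, hm⟩, huniq⟩
  refine ⟨hex, ?_⟩
  rw [saddlepoint, dif_pos hex]
  exact huniq _ hex.exists.choose_spec

lemma abs_sqrt_sub_one_le {θ : ℝ} (hθ : -1 ≤ θ) : |√(1 + θ) - 1| ≤ |θ| := by
  have h1 : (√(1 + θ) - 1) * (√(1 + θ) + 1) = θ := by
    have := Real.sq_sqrt (by linarith : 0 ≤ 1 + θ)
    linear_combination this
  have h2 := Real.sqrt_nonneg (1 + θ)
  calc |√(1 + θ) - 1| ≤ |√(1 + θ) - 1| * |√(1 + θ) + 1| := by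
        refine le_mul_of_one_le_right (abs_nonneg _) ?_
        rw [abs_of_nonneg (by linarith : 0 ≤ √(1 + θ) + 1)]; linarith
    _ = |θ| := by rw [← abs_mul, h1]

/-- All statistics are close to `ŝ √(∑ xᵢ²)`. -/
lemma exists_statistics_eq {n : ℕ} (x : Fin n → ℝ) {s D : ℝ} (hx : 0 < ∑ i, x i ^ 2)
    (hD : ∑ i, x i ^ 4 ≤ D * ∑ i, x i ^ 2) (hsD : D * s ^ 2 ≤ 1 / 2)
    (hs : saddlepoint x = s) (hm : tiltMean x s = ∑ i, x i) :
    ∃ a b d : ℝ, |a - 1| ≤ D * s ^ 2 ∧ |b - 1| ≤ D * s ^ 2 ∧ |d - 1| ≤ D * s ^ 2 ∧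
      rStat x = s * √(∑ i, x i ^ 2) * a ∧ lam x = s * √(∑ i, x i ^ 2) * b ∧
      (√(∑ i, x i ^ 2))⁻¹ * ∑ i, x i = s * √(∑ i, x i ^ 2) * d ∧
      rSq x = (s * √(∑ i, x i ^ 2) * a) ^ 2 := by
  set B := ∑ i, x i ^ 2 with hB
  have hRB : √B ^ 2 = B := Real.sq_sqrt hx.le
  have hR0 : 0 < √B := Real.sqrt_pos.2 hx
  have hD0 : 0 ≤ D := by
    by_contra h
    have h2 : 0 ≤ ∑ i, x i ^ 4 := Finset.sum_nonneg fun i _ => by positivity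
    nlinarith [mul_pos (neg_pos.2 (not_le.1 h)) hx]
  have hDs0 : 0 ≤ D * s ^ 2 := by positivity
  -- The saddlepoint equation replaces `∑ xᵢ` by the tilted mean, which removes the linear term and
  -- leaves a summand `u² + O(u⁴)` in `u = s xᵢ`.
  have hrSq : rSq x = ∑ i, 2 * (s * x i * Real.tanh (s * x i) -
      Real.log (Real.cosh (s * x i))) := by
    rw [rSq, hs, Finset.sum_sub_distrib, ← Finset.mul_sum, ← hm, ← Finset.mul_sum,
      Finset.sum_sub_distrib, tiltMean, Finset.mul_sum]
    simp only [mul_assoc]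
  have hlam : lam x = s * √(∑ i, x i ^ 2 * (1 - Real.tanh (s * x i) ^ 2)) := by
    rw [lam, hs]
    congr 2
    refine Finset.sum_congr rfl fun i _ => ?_
    rw [mul_assoc 2 s (x i), ← exp_two_mul_div_eq]
    ring
  -- At `s = 0` all statistics vanish and any factors would serve.
  rcases eq_or_ne s 0 with h0 | h0
  · have hsum : ∑ i, x i = 0 := by rw [← hm, h0, tiltMean_zero]
    refine ⟨1, 1, 1, by simpa using hDs0, by simpa using hDs0, by simpa using hDs0, ?_, ?_, ?_, ?_⟩
    · rw [rStat, hs, h0]; simp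
    · rw [hlam, h0]; simp
    · rw [hsum, h0]; simp
    · rw [hrSq, h0]; simp
  have hs2 : 0 < s ^ 2 := by positivity
  have hs4 : s ^ 4 * ∑ i, x i ^ 4 ≤ s ^ 2 * B * (D * s ^ 2) := by
    calc _ ≤ s ^ 4 * (D * B) := by gcongr
      _ = _ := by ring
  -- Any `f(u) = u² + O(u⁴)` sums to `s² B` with relative error at most `D s²`. The squares of `r`
  -- and `λ`, and `s ∑ xᵢ`, are three such sums.
  have hbound : ∀ f : ℝ → ℝ, (∀ u, |f u - u ^ 2| ≤ u ^ 4) →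
      |(∑ i, f (s * x i)) / (s ^ 2 * B) - 1| ≤ D * s ^ 2 := by
    intro f hf
    have h1 : |∑ i, f (s * x i) - s ^ 2 * B| ≤ s ^ 4 * ∑ i, x i ^ 4 := by
      rw [hB, Finset.mul_sum, Finset.mul_sum, ← Finset.sum_sub_distrib]
      refine (Finset.abs_sum_le_sum_abs _ _).trans (Finset.sum_le_sum fun i _ => ?_)
      have := hf (s * x i)
      rwa [mul_pow, mul_pow] at this
    have h2 : (∑ i, f (s * x i)) / (s ^ 2 * B) - 1 =
        (∑ i, f (s * x i) - s ^ 2 * B) / (s ^ 2 * B) := by field_simp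
    rw [h2, abs_div, abs_of_pos (by positivity : 0 < s ^ 2 * B), div_le_iff₀ (by positivity)]
    linarith
  have hr := hbound (fun u => 2 * (u * Real.tanh u - Real.log (Real.cosh u)))
    abs_two_mul_tanh_sub_log_cosh
  have hl := hbound (fun u => u ^ 2 * (1 - Real.tanh u ^ 2)) abs_sq_mul_one_sub_tanh_sq
  have hz := hbound (fun u => u * Real.tanh u) fun u => by
    have h4 : 0 ≤ u ^ 4 := by positivity
    rw [abs_le]
    constructor
    · linarith [mul_tanh_ge u]
    · linarith [mul_tanh_le u]
  rw [← hrSq] at hr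
  have hr1 := (abs_le.1 hr).1
  have hl1 := (abs_le.1 hl).1
  set θ := rSq x / (s ^ 2 * B) - 1 with hθ
  set V := ∑ i, x i ^ 2 * (1 - Real.tanh (s * x i) ^ 2) with hV
  have hVs : ∑ i, (s * x i) ^ 2 * (1 - Real.tanh (s * x i) ^ 2) = s ^ 2 * V := by
    rw [hV, Finset.mul_sum]
    exact Finset.sum_congr rfl fun i _ => by ring
  rw [hVs] at hl hl1
  set θ' := s ^ 2 * V / (s ^ 2 * B) - 1 with hθ'
  have hrS : rSq x = s ^ 2 * B * (1 + θ) := by rw [hθ]; field_simp; ring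
  have hVS : V = B * (1 + θ') := by rw [hθ']; field_simp; ring
  have hzs : (∑ i, s * x i * Real.tanh (s * x i)) = s * ∑ i, x i := by
    rw [← hm, tiltMean, Finset.mul_sum]; simp only [mul_assoc]
  rw [hzs] at hz
  refine ⟨√(1 + θ), √(1 + θ'), s * (∑ i, x i) / (s ^ 2 * B),
    (abs_sqrt_sub_one_le (by linarith)).trans hr,
    (abs_sqrt_sub_one_le (by linarith)).trans hl, hz, ?_, ?_, ?_, ?_⟩
  · rw [rStat, if_pos (by rw [hrS]; exact mul_nonneg (by positivity) (by linarith)), hs, hrS,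
      Real.sqrt_mul (by positivity), Real.sqrt_mul (sq_nonneg s), Real.sqrt_sq_eq_abs,
      ← mul_assoc, ← mul_assoc]
    congr 2
    rcases lt_or_gt_of_ne h0 with h | h
    · rw [Real.sign_of_neg h, abs_of_neg h]; ring
    · rw [Real.sign_of_pos h, abs_of_pos h]; ring
  · rw [hlam, hVS, Real.sqrt_mul hx.le]; ring
  · rw [show s ^ 2 * B = s ^ 2 * √B ^ 2 by rw [hRB]]
    field_simp
  · rw [mul_pow, mul_pow, hRB, Real.sq_sqrt (by linarith), hrS]

/-! ### Asymptotic validity of the Lugannani-Rice approximation for arrays of numbers -/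

/-- Arrays of numbers along which the saddlepoint equation is solvable with solutions tending
to `0`. -/
structure SaddleRegime (n : ℕ → ℕ) (x : ∀ k, Fin (n k) → ℝ) (D : ℝ) : Prop where
  regime : Regime n x (fun k => saddlepoint (x k)) D
  tiltMean_eq : ∀ k, tiltMean (x k) (saddlepoint (x k)) = ∑ i, x k i
  sum_sq_pos : ∀ k, 0 < ∑ i, x k i ^ 2
  small : ∀ k, D * saddlepoint (x k) ^ 2 ≤ 1 / 2

/-- The common scale `ŝ √(∑ xᵢ²)` of the statistics. -/
def scale {m : ℕ} (x : Fin m → ℝ) : ℝ := saddlepoint x * √(∑ i, x i ^ 2)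

section

variable {n : ℕ → ℕ} {x : ∀ k, Fin (n k) → ℝ} {D : ℝ}

lemma SaddleRegime.comp (h : SaddleRegime n x D) {φ : ℕ → ℕ} (hφ : StrictMono φ) :
    SaddleRegime (fun k => n (φ k)) (fun k => x (φ k)) D where
  regime := ⟨h.regime.tendsto_sum_sq.comp hφ.tendsto_atTop, fun _ => h.regime.sum_pow_four_le _,
    h.regime.tendsto_tilt.comp hφ.tendsto_atTop⟩
  tiltMean_eq _ := h.tiltMean_eq _
  sum_sq_pos _ := h.sum_sq_pos _
  small _ := h.small _

/-- The difference `1/λ - 1/r` tends to `0` even where the scale itself is near `0`: its numerator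
`a - b` is `O(D s²)` and its denominator is of order `|s| √B`. The constant `8` is the `2` in `|a -
b| ≤ 2 D s²` divided by `a b ≥ 1/4`. -/
lemma SaddleRegime.exists_statistics (h : SaddleRegime n x D) :
    ∃ a b d : ℕ → ℝ, Tendsto a atTop (𝓝 1) ∧ Tendsto b atTop (𝓝 1) ∧ Tendsto d atTop (𝓝 1) ∧
      Tendsto (fun k => 1 / lam (x k) - 1 / rStat (x k)) atTop (𝓝 0) ∧
      ∀ k, rStat (x k) = scale (x k) * a k ∧ lam (x k) = scale (x k) * b k ∧
        (√(∑ i, x k i ^ 2))⁻¹ * ∑ i, x k i = scale (x k) * d k ∧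
        rSq (x k) = (scale (x k) * a k) ^ 2 := by
  choose a b d ha hb hd hr hl hz hq using fun k => exists_statistics_eq (x k) (h.sum_sq_pos k)
    (h.regime.sum_pow_four_le k) (h.small k) rfl (h.tiltMean_eq k)
  have hs0 : Tendsto (fun k => D * saddlepoint (x k) ^ 2) atTop (𝓝 0) := by
    simpa using (h.regime.tendsto_tilt.pow 2).const_mul D
  have hone : ∀ f : ℕ → ℝ, (∀ k, |f k - 1| ≤ D * saddlepoint (x k) ^ 2) →
      Tendsto f atTop (𝓝 1) := fun f hf => by
    rw [tendsto_iff_norm_sub_tendsto_zero]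
    exact squeeze_zero (fun k => norm_nonneg _) hf hs0
  refine ⟨a, b, d, hone a ha, hone b hb, hone d hd, ?_, fun k => ⟨hr k, hl k, hz k, hq k⟩⟩
  have hlim : Tendsto (fun k => 8 * D * |saddlepoint (x k)| * (√(∑ i, x k i ^ 2))⁻¹) atTop
      (𝓝 0) := by
    have := (h.regime.tendsto_tilt.abs.const_mul (8 * D)).mul
      h.regime.tendsto_sqrt.inv_tendsto_atTop
    simpa using this
  rw [tendsto_zero_iff_norm_tendsto_zero]
  refine squeeze_zero (fun k => norm_nonneg _) (fun k => ?_) hlim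
  have hD := h.regime.nonneg
  have hR : 0 < √(∑ i, x k i ^ 2) := Real.sqrt_pos.2 (h.sum_sq_pos k)
  have ha' := abs_le.1 ((ha k).trans (h.small k))
  have hb' := abs_le.1 ((hb k).trans (h.small k))
  have ha0 : 1 / 2 ≤ a k := by linarith
  have hb0 : 1 / 2 ≤ b k := by linarith
  rw [hr k, hl k]
  set s := saddlepoint (x k)
  set R := √(∑ i, x k i ^ 2)
  rcases eq_or_ne s 0 with h0 | h0
  · simp [h0]
  have hab : |a k - b k| ≤ 2 * (D * s ^ 2) := by
    have : a k - b k = (a k - 1) - (b k - 1) := by ring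
    rw [this]
    exact (abs_sub _ _).trans (by linarith [ha k, hb k])
  have hapos : 0 < a k := by linarith
  have hbpos : 0 < b k := by linarith
  have heq : 1 / (s * R * b k) - 1 / (s * R * a k) = (a k - b k) / (s * R * (a k * b k)) := by
    field_simp
  have hs2 : 0 < |s| := abs_pos.2 h0
  rw [heq, norm_div, Real.norm_eq_abs, Real.norm_eq_abs, abs_mul, abs_mul, abs_of_pos hR,
    abs_of_pos (mul_pos hapos hbpos), div_le_iff₀ (by positivity)]
  have hq4 : 1 / 4 ≤ a k * b k := by nlinarith
  have : 8 * D * |s| * R⁻¹ * (|s| * R * (a k * b k)) = 8 * (D * s ^ 2) * (a k * b k) := by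
    rw [← sq_abs s]; field_simp
  rw [this]
  have hds : 0 ≤ D * s ^ 2 := by positivity
  nlinarith

lemma Regime.untilted {s : ℕ → ℝ} (h : Regime n x s D) : Regime n x (fun _ => 0) D :=
  ⟨h.tendsto_sum_sq, h.sum_pow_four_le, tendsto_const_nhds⟩

/-- Monotonicity traps `G k (z k)` between the values at fixed points on either side of `l`, so
pointwise convergence carries over to moving arguments. -/
lemma tendsto_apply_of_antitone {G : ℕ → ℝ → ℝ} {g : ℝ → ℝ} {z : ℕ → ℝ} {l : ℝ}
    (hG : ∀ k, Antitone (G k)) (hGg : ∀ t, Tendsto (fun k => G k t) atTop (𝓝 (g t)))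
    (hg : ContinuousAt g l) (hz : Tendsto z atTop (𝓝 l)) :
    Tendsto (fun k => G k (z k)) atTop (𝓝 (g l)) := by
  rw [tendsto_order]
  constructor
  · intro b hb
    have h1 : ∀ᶠ t in 𝓝[>] l, b < g t :=
      (hg.tendsto.eventually_const_lt hb).filter_mono nhdsWithin_le_nhds
    obtain ⟨t, ht, hlt⟩ := (h1.and self_mem_nhdsWithin).exists
    filter_upwards [(hGg t).eventually_const_lt ht, hz.eventually_lt_const hlt] with k h2 h3
    exact h2.trans_le (hG k h3.le)
  · intro b hb
    have h1 : ∀ᶠ t in 𝓝[<] l, g t < b :=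
      (hg.tendsto.eventually_lt_const hb).filter_mono nhdsWithin_le_nhds
    obtain ⟨t, ht, hlt⟩ := (h1.and self_mem_nhdsWithin).exists
    filter_upwards [(hGg t).eventually_lt_const ht, hz.eventually_const_lt hlt] with k h2 h3
    exact (hG k h3.le).trans_lt h2

lemma SaddleRegime.tendsto_lugannaniRice_sub (h : SaddleRegime n x D) :
    Tendsto (fun k => lugannaniRice (x k) - (1 - stdNormalCDF (rStat (x k)))) atTop (𝓝 0) := by
  obtain ⟨a, b, d, -, -, -, hdiff, -⟩ := h.exists_statistics
  rw [tendsto_zero_iff_norm_tendsto_zero] at hdiff ⊢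
  refine squeeze_zero (fun k => norm_nonneg _) (fun k => ?_) hdiff
  have : lugannaniRice (x k) - (1 - stdNormalCDF (rStat (x k))) =
      stdNormalPDF (rStat (x k)) * (1 / lam (x k) - 1 / rStat (x k)) := by
    rw [lugannaniRice]; ring
  rw [this, norm_mul]
  refine mul_le_of_le_one_left (norm_nonneg _) ?_
  rw [Real.norm_of_nonneg (show 0 ≤ stdNormalPDF _ from gaussianPDFReal_nonneg _ _ _)]
  exact stdNormalPDF_le_one _

lemma SaddleRegime.flipProb_eq (h : SaddleRegime n x D) (k : ℕ) :
    flipProb (x k) = (tiltLaw (x k) 0 (√(∑ i, x k i ^ 2))⁻¹).real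
      (Set.Ici ((√(∑ i, x k i ^ 2))⁻¹ * ∑ i, x k i)) :=
  flipProb_eq_tiltLaw _ (inv_pos.2 (Real.sqrt_pos.2 (h.sum_sq_pos k)))

lemma antitone_real_Ici (ν : Measure ℝ) [IsFiniteMeasure ν] :
    Antitone fun z => ν.real (Set.Ici z) :=
  fun _ _ hab => measureReal_mono (Set.Ici_subset_Ici.2 hab)

/-- Both the standardised threshold and `r` tend to `l`, so p-value and approximation share the
limit `1 - Φ(l)`, which is not zero. -/
lemma SaddleRegime.tendsto_ratio_of_tendsto_nhds (h : SaddleRegime n x D) {l : ℝ}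
    (hl : Tendsto (fun k => scale (x k)) atTop (𝓝 l)) :
    Tendsto (fun k => flipProb (x k) / lugannaniRice (x k)) atTop (𝓝 1) := by
  obtain ⟨a, b, d, ha, hb, hd, -, hst⟩ := h.exists_statistics
  have hp : Tendsto (fun k => flipProb (x k)) atTop (𝓝 (1 - stdNormalCDF l)) := by
    simp_rw [h.flipProb_eq]
    refine tendsto_apply_of_antitone (g := fun t => 1 - stdNormalCDF t)
      (fun k => antitone_real_Ici (tiltLaw (x k) 0 (√(∑ i, x k i ^ 2))⁻¹))
      (fun t => h.regime.untilted.tendsto_tiltLaw_Ici t)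
      (continuous_const.sub continuous_stdNormalCDF).continuousAt ?_
    simpa [(hst _).2.2.1] using hl.mul hd
  have hr : Tendsto (fun k => rStat (x k)) atTop (𝓝 l) := by
    simpa [(hst _).1] using hl.mul ha
  have hq : Tendsto (fun k => lugannaniRice (x k)) atTop (𝓝 (1 - stdNormalCDF l)) := by
    have := h.tendsto_lugannaniRice_sub.add
      (((continuous_stdNormalCDF.tendsto l).comp hr).const_sub 1)
    simpa [Function.comp_def] using this
  have hne : 1 - stdNormalCDF l ≠ 0 := (sub_pos.2 (stdNormalCDF_lt_one l)).ne'
  exact (div_self hne ▸ hp.div hq hne :)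

lemma SaddleRegime.tendsto_ratio_of_tendsto_atBot (h : SaddleRegime n x D)
    (hl : Tendsto (fun k => scale (x k)) atTop atBot) :
    Tendsto (fun k => flipProb (x k) / lugannaniRice (x k)) atTop (𝓝 1) := by
  obtain ⟨a, b, d, ha, hb, hd, -, hst⟩ := h.exists_statistics
  have hz : Tendsto (fun k => (√(∑ i, x k i ^ 2))⁻¹ * ∑ i, x k i) atTop atBot := by
    simp_rw [(hst _).2.2.1]
    exact hl.atBot_mul_pos one_pos hd
  have hr : Tendsto (fun k => rStat (x k)) atTop atBot := by
    simp_rw [(hst _).1]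
    exact hl.atBot_mul_pos one_pos ha
  have hcdf : Tendsto stdNormalCDF atBot (𝓝 0) := tendsto_cdf_atBot _
  have hp : Tendsto (fun k => flipProb (x k)) atTop (𝓝 1) := by
    simp_rw [h.flipProb_eq]
    rw [tendsto_order]
    constructor
    · intro b hb
      have h1 : Tendsto (fun t => 1 - stdNormalCDF t) atBot (𝓝 1) := by
        simpa using hcdf.const_sub 1
      obtain ⟨t, ht⟩ := (h1.eventually_const_lt hb).exists
      filter_upwards [(h.regime.untilted.tendsto_tiltLaw_Ici t).eventually_const_lt ht,
        hz.eventually_le_atBot t] with k h2 h3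
      exact h2.trans_le (antitone_real_Ici _ h3)
    · intro b hb
      exact Eventually.of_forall fun k => measureReal_le_one.trans_lt hb
  have hq : Tendsto (fun k => lugannaniRice (x k)) atTop (𝓝 1) := by
    have := h.tendsto_lugannaniRice_sub.add ((hcdf.comp hr).const_sub 1)
    simpa [Function.comp_def] using this
  exact (div_self (one_ne_zero (α := ℝ)) ▸ hp.div hq one_ne_zero :)

/-- Both quantities are multiplied by `scale · exp (r²/2)`. The p-value becomes `scale · halfLaplace
→ c`. The approximation becomes the Mills term over `a`, which tends to `c`, plus `c (1/b - 1/a) →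
0`. -/
lemma SaddleRegime.tendsto_ratio_of_tendsto_atTop (h : SaddleRegime n x D)
    (hs : ∀ k, 0 < saddlepoint (x k)) (hl : Tendsto (fun k => scale (x k)) atTop atTop) :
    Tendsto (fun k => flipProb (x k) / lugannaniRice (x k)) atTop (𝓝 1) := by
  obtain ⟨a, b, d, ha, hb, hd, -, hst⟩ := h.exists_statistics
  set c : ℝ := (√(2 * Real.pi))⁻¹ with hc
  have hc0 : 0 < c := by positivity
  have hr : Tendsto (fun k => rStat (x k)) atTop atTop := by
    simp_rw [(hst _).1]
    exact hl.atTop_mul_pos one_pos ha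
  have hpos : ∀ k, 0 < scale (x k) := fun k =>
    mul_pos (hs k) (Real.sqrt_pos.2 (h.sum_sq_pos k))
  have hp : Tendsto (fun k => scale (x k) * halfLaplace (x k) (saddlepoint (x k))) atTop (𝓝 c) :=
    h.regime.tendsto_halfLaplace hs hl
  have hq : Tendsto (fun k => (rStat (x k) * Real.exp (rStat (x k) ^ 2 / 2) *
      (1 - stdNormalCDF (rStat (x k)))) * (a k)⁻¹ + c * ((b k)⁻¹ - (a k)⁻¹)) atTop (𝓝 c) := by
    have h1 := ha.inv₀ one_ne_zero
    have h2 := hb.inv₀ one_ne_zero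
    have := ((tendsto_mills.comp hr).mul h1).add ((h2.sub h1).const_mul c)
    rw [inv_one, mul_one, sub_self, mul_zero, add_zero] at this
    exact this
  have hratio := hp.div hq hc0.ne'
  rw [div_self hc0.ne'] at hratio
  refine hratio.congr' ?_
  filter_upwards [ha.eventually_ne one_ne_zero, hb.eventually_ne one_ne_zero] with k ha0 hb0
  obtain ⟨h1, h2, h3, h4⟩ := hst k
  have hflip := flipProb_eq_halfLaplace (x k) (hs k) (h.tiltMean_eq k)
  have hrs : ∑ i, (saddlepoint (x k) * x k i - Real.log (Real.cosh (saddlepoint (x k) * x k i))) =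
      rStat (x k) ^ 2 / 2 := by
    have : rSq (x k) = rStat (x k) ^ 2 := by rw [h4, h1]
    rw [← this, rSq]; ring
  rw [hrs, Real.exp_neg] at hflip
  have hE := Real.exp_pos (rStat (x k) ^ 2 / 2)
  have hL := hpos k
  have hnum : scale (x k) * halfLaplace (x k) (saddlepoint (x k)) =
      flipProb (x k) * (scale (x k) * Real.exp (rStat (x k) ^ 2 / 2)) := by
    rw [hflip]; field_simp
  have hden : (rStat (x k) * Real.exp (rStat (x k) ^ 2 / 2) *
      (1 - stdNormalCDF (rStat (x k)))) * (a k)⁻¹ + c * ((b k)⁻¹ - (a k)⁻¹) =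
      lugannaniRice (x k) * (scale (x k) * Real.exp (rStat (x k) ^ 2 / 2)) := by
    rw [lugannaniRice, stdNormalPDF_eq, ← hc, Real.exp_neg, h2]
    set E := Real.exp (rStat (x k) ^ 2 / 2)
    rw [h1]
    generalize stdNormalCDF (scale (x k) * a k) = F
    field_simp
  simp only [Pi.div_apply]
  rw [hnum, hden, mul_div_mul_right _ _ (by positivity)]

/-- Some subsequence has vanishing relative error. -/
lemma SaddleRegime.exists_subseq (h : SaddleRegime n x D) :
    ∃ φ : ℕ → ℕ, Tendsto (fun k => flipProb (x (φ k)) / lugannaniRice (x (φ k))) atTop (𝓝 1) := by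
  obtain ⟨l, -, φ, hφ, hl⟩ := isCompact_univ.tendsto_subseq
    (x := fun k => ((scale (x k) : ℝ) : EReal)) fun k => Set.mem_univ _
  have h' := h.comp hφ
  induction l with
  | bot => exact ⟨φ, h'.tendsto_ratio_of_tendsto_atBot (EReal.tendsto_coe_nhds_bot_iff.1 hl)⟩
  | coe l => exact ⟨φ, h'.tendsto_ratio_of_tendsto_nhds (EReal.tendsto_coe.1 hl)⟩
  | top =>
    have hl' := EReal.tendsto_coe_nhds_top_iff.1 hl
    -- A positive scale forces a positive saddlepoint, but only eventually; one more extraction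
    -- gives it at every index.
    have hpos : ∀ᶠ k in atTop, 0 < saddlepoint (x (φ k)) := by
      filter_upwards [hl'.eventually_gt_atTop 0] with k hk
      exact pos_of_mul_pos_left hk (Real.sqrt_nonneg _)
    obtain ⟨ψ, hψ, hpos⟩ := extraction_of_eventually_atTop hpos
    exact ⟨φ ∘ ψ, (h'.comp hψ).tendsto_ratio_of_tendsto_atTop hpos (hl'.comp hψ.tendsto_atTop)⟩

end

/-- Uniform accuracy of the Lugannani-Rice approximation for fixed data. -/
theorem exists_uniform_bound (D : ℝ) {η : ℝ} (hη : 0 < η) :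
    ∃ δ > 0, ∀ (n : ℕ) (x : Fin n → ℝ), δ⁻¹ ≤ ∑ i, x i ^ 2 →
      ∑ i, x i ^ 4 ≤ D * ∑ i, x i ^ 2 → |∑ i, x i| ≤ δ * ∑ i, x i ^ 2 →
      (∃! s, s ∈ solutionSet x) ∧ |flipProb x / lugannaniRice x - 1| ≤ η := by
  -- Counterexamples for `δ = 1/(k+1)` form an array with `B → ∞` and `∑ xᵢ / B → 0`.
  by_contra! hcon
  have hpos : ∀ k : ℕ, (0 : ℝ) < 1 / ((k : ℝ) + 1) := fun k => Nat.one_div_pos_of_nat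
  choose n x hB h4 hm hbad using fun k : ℕ => hcon (1 / ((k : ℝ) + 1)) (hpos k)
  have hB' : ∀ k : ℕ, (k : ℝ) + 1 ≤ ∑ i, x k i ^ 2 := fun k => by simpa using hB k
  have hBpos : ∀ k : ℕ, 0 < ∑ i, x k i ^ 2 := fun k =>
    lt_of_lt_of_le (by positivity) (hB' k)
  have hsmall : ∀ e : ℝ, 0 < e → e ≤ 1 → D * e ^ 2 ≤ 1 / 2 → ∀ᶠ k in atTop,
      |saddlepoint (x k)| ≤ e ∧ (∃! s, s ∈ solutionSet (x k)) ∧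
        tiltMean (x k) (saddlepoint (x k)) = ∑ i, x k i := by
    intro e he he1 hDe
    filter_upwards [(tendsto_one_div_add_atTop_nhds_zero_nat (𝕜 := ℝ)).eventually_lt_const
      (half_pos he)] with k hk
    obtain ⟨s, hs, hs'⟩ := exists_tiltMean_eq (x k) he (h4 k) hDe
      ((hm k).trans (mul_le_mul_of_nonneg_right hk.le (hBpos k).le))
    obtain ⟨h1, h2⟩ := existsUnique_and_saddlepoint (x k) (hBpos k) (hs.trans he1) hs'
    rw [h2]
    exact ⟨hs, h1, hs'⟩
  -- A fixed radius on which the tilt condition holds. The absolute value lets the bound pass to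
  -- smaller radii whatever the sign of `D`.
  obtain ⟨e₀, he0, he1, heD⟩ : ∃ e : ℝ, 0 < e ∧ e ≤ 1 ∧ |D| * e ^ 2 ≤ 1 / 2 := by
    have h1 : Tendsto (fun e : ℝ => |D| * e ^ 2) (𝓝[>] 0) (𝓝 0) := by
      have : Continuous fun e : ℝ => |D| * e ^ 2 := by fun_prop
      simpa using (this.tendsto 0).mono_left nhdsWithin_le_nhds
    obtain ⟨e, he, he', he''⟩ := ((h1.eventually_lt_const (by norm_num : (0 : ℝ) < 1 / 2)).and
      (Ioc_mem_nhdsGT (zero_lt_one (α := ℝ)))).exists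
    exact ⟨e, he', he'', he.le⟩
  have hDe : ∀ e : ℝ, 0 < e → e ≤ e₀ → D * e ^ 2 ≤ 1 / 2 := fun e he hee => by
    refine le_trans ?_ heD
    have := le_abs_self D
    gcongr
  have hs0 : Tendsto (fun k => saddlepoint (x k)) atTop (𝓝 0) := by
    rw [Metric.tendsto_nhds]
    intro e he
    filter_upwards [hsmall (min (e / 2) e₀) (by positivity) ((min_le_right _ _).trans he1)
      (hDe _ (by positivity) (min_le_right _ _))] with k hk
    rw [Real.dist_eq, sub_zero]
    linarith [hk.1.trans (min_le_left _ _)]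
  have hev := hsmall e₀ he0 he1 (hDe _ he0 le_rfl)
  obtain ⟨φ, hφ, hP⟩ := extraction_of_eventually_atTop hev
  have hBt : Tendsto (fun k => ∑ i, x k i ^ 2) atTop atTop :=
    tendsto_atTop_mono hB' (tendsto_atTop_add_const_right _ _ tendsto_natCast_atTop_atTop)
  have hreg : SaddleRegime (fun k => n (φ k)) (fun k => x (φ k)) D :=
    { regime := ⟨hBt.comp hφ.tendsto_atTop, fun k => h4 _, hs0.comp hφ.tendsto_atTop⟩
      tiltMean_eq := fun k => (hP k).2.2
      sum_sq_pos := fun k => hBpos _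
      small := fun k => by
        refine le_trans ?_ heD
        have h1 : saddlepoint (x (φ k)) ^ 2 ≤ e₀ ^ 2 := by
          rw [← sq_abs]; gcongr; exact (hP k).1
        have := le_abs_self D
        gcongr }
  obtain ⟨ψ, hψ⟩ := hreg.exists_subseq
  have h1 : Tendsto (fun k => |flipProb (x (φ (ψ k))) / lugannaniRice (x (φ (ψ k))) - 1|) atTop
      (𝓝 0) := by simpa using (hψ.sub_const 1).abs
  obtain ⟨k, hk⟩ := (h1.eventually_lt_const hη).exists
  -- Unique solvability holds along `φ`, so a counterexample there must violate the error bound, at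
  -- odds with the limit. One index suffices.
  exact absurd (hbad _ (hP (ψ k)).2.1) (not_lt.2 hk.le)

/-! ### The sign-flipping p-value of random data -/

lemma sgn_injective : Function.Injective sgn := by
  intro a b h
  cases a <;> cases b <;> simp [sgn] at h ⊢ <;> norm_num at h

lemma rademacher_singleton (b : Bool) : rademacher {sgn b} = 2⁻¹ := by
  cases b <;> simp [rademacher, sgn] <;> norm_num

lemma rademacher_compl : rademacher (Set.range sgn)ᶜ = 0 := by
  simp [rademacher, sgn]

lemma measure_signs_eq {Ω : Type*} [MeasurableSpace Ω] {P : Measure Ω} {n : ℕ}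
    {π : Fin n → Ω → ℝ} (hπ : ∀ i, Measurable (π i))
    (hlaw : ∀ i, P.map (π i) = rademacher) (hind : iIndepFun π P) (σ : Fin n → Bool) :
    P {ω | ∀ i, π i ω = sgn (σ i)} = (2⁻¹ : ℝ≥0∞) ^ n := by
  have h1 : {ω | ∀ i, π i ω = sgn (σ i)} = ⋂ i ∈ (Finset.univ : Finset (Fin n)),
      π i ⁻¹' {sgn (σ i)} := by ext ω; simp
  rw [h1, hind.measure_inter_preimage_eq_mul Finset.univ
    (fun i _ => measurableSet_singleton (sgn (σ i)))]
  have h2 : ∀ i, P (π i ⁻¹' {sgn (σ i)}) = 2⁻¹ := fun i => by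
    rw [← Measure.map_apply (hπ i) (measurableSet_singleton _), hlaw, rademacher_singleton]
  simp [h2]

lemma dataSigma_eq_comap {Ω : Type*} {n : ℕ} (X : Fin n → Ω → ℝ) :
    dataSigma X = MeasurableSpace.comap (fun ω i => X i ω) MeasurableSpace.pi := by
  simp only [dataSigma, MeasurableSpace.pi, MeasurableSpace.comap_iSup, MeasurableSpace.comap_comp]
  rfl

/-- The conditional sign-flipping p-value is the proportion of sign vectors. -/
lemma pValue_ae_eq_flipProb {Ω : Type*} [MeasurableSpace Ω] {P : Measure Ω} [IsProbabilityMeasure P] {n : ℕ}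
    {π X : Fin n → Ω → ℝ} (hX : ∀ i, Measurable (X i))
    (hπ : ∀ i, Measurable (π i)) (hlaw : ∀ i, P.map (π i) = rademacher) (hind : iIndepFun π P)
    (hXπ : IndepFun (fun ω i => X i ω) (fun ω i => π i ω) P) :
    pValue P π X =ᵐ[P] fun ω => flipProb fun i => X i ω := by
  have hXm : Measurable fun ω i => X i ω := measurable_pi_lambda _ hX
  have hπm : Measurable fun ω i => π i ω := measurable_pi_lambda _ hπ
  have hle : dataSigma X ≤ ‹MeasurableSpace Ω› := by
    rw [dataSigma_eq_comap]; exact hXm.comap_le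
  set A : (Fin n → Bool) → Ω → ℝ := fun σ ω =>
    if ∑ i, X i ω ≤ signSum (fun i => X i ω) σ then 1 else 0 with hA
  set S : (Fin n → Bool) → Set Ω := fun σ => {ω | ∀ i, π i ω = sgn (σ i)} with hS
  set T : (Fin n → Bool) → Ω → ℝ := fun σ => (S σ).indicator fun _ => 1 with hT
  have hSpre : ∀ σ, S σ = (fun ω i => π i ω) ⁻¹' {fun i => sgn (σ i)} := fun σ => by
    ext ω; simp [hS, funext_iff]
  have hSm : ∀ σ, MeasurableSet (S σ) := fun σ => by
    rw [hSpre]; exact hπm (measurableSet_singleton _)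
  have hAm : ∀ σ, StronglyMeasurable[dataSigma X] (A σ) := fun σ => by
    rw [dataSigma_eq_comap]
    have hg : Measurable fun x : Fin n → ℝ => if ∑ i, x i ≤ signSum x σ then (1 : ℝ) else 0 := by
      refine Measurable.ite (measurableSet_le (by fun_prop) ?_) measurable_const measurable_const
      unfold signSum; fun_prop
    exact (hg.comp (comap_measurable _)).stronglyMeasurable
  have hTi : ∀ σ, Integrable (T σ) P := fun σ =>
    (integrable_const 1).indicator (hSm σ)
  have hA1 : ∀ σ ω, ‖A σ ω‖ ≤ 1 := fun σ ω => by
    simp only [hA]; split_ifs <;> simp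
  have hATi : ∀ σ, Integrable (A σ * T σ) P := fun σ =>
    (hTi σ).bdd_mul ((hAm σ).mono hle).aestronglyMeasurable (ae_of_all _ (hA1 σ))
  have hrange : ∀ᵐ ω ∂P, ∀ i, π i ω ∈ Set.range sgn := by
    rw [ae_all_iff]
    intro i
    have h1 : P.map (π i) (Set.range sgn)ᶜ = 0 := by rw [hlaw, rademacher_compl]
    rw [Measure.map_apply (hπ i) (Set.finite_range sgn).measurableSet.compl] at h1
    exact h1
  -- Almost surely the signs are `±1`, and the event splits over sign vectors into a factor `A σ`
  -- determined by the data and an indicator `T σ` independent of them.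
  have hdecomp : ({ω | mean (fun i => X i ω) ≤ mean (fun i => π i ω * X i ω)}.indicator
      fun _ => (1 : ℝ)) =ᵐ[P] ∑ σ, A σ * T σ := by
    filter_upwards [hrange] with ω hω
    choose τ hτ using hω
    rw [Finset.sum_apply, Finset.sum_eq_single τ]
    · have hτS : ω ∈ S τ := fun i => (hτ i).symm
      have hmean : mean (fun i => X i ω) ≤ mean (fun i => π i ω * X i ω) ↔
          ∑ i, X i ω ≤ signSum (fun i => X i ω) τ := by
        simp only [mean, signSum, hτ]
        -- For `n = 0` the factor `1/n` is `0`, and both inequalities read `0 ≤ 0`.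
        rcases Nat.eq_zero_or_pos n with h0 | h0
        · subst h0; simp
        · exact mul_le_mul_iff_right₀ (by positivity)
      simp only [Pi.mul_apply, hT, hA, Set.indicator, Set.mem_ofPred_eq, hmean]
      rw [if_pos hτS, mul_one]
    · intro σ _ hσ
      have : ω ∉ S σ := fun h => hσ (funext fun i => sgn_injective ((h i).symm.trans (hτ i).symm))
      simp [hT, Set.indicator_of_notMem this]
    · simp
  have hcond : ∀ σ, P[A σ * T σ | dataSigma X] =ᵐ[P] fun ω => A σ ω * (2 ^ n)⁻¹ := fun σ => by
    have h1 := condExp_mul_of_stronglyMeasurable_left (hAm σ) (hATi σ) (hTi σ)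
    have h2 : P[T σ | dataSigma X] =ᵐ[P] fun _ => P[T σ] := by
      refine condExp_indep_eq hπm.comap_le hle (f := T σ) ?_ ?_
      · refine stronglyMeasurable_const.indicator ?_
        rw [hSpre]
        exact ⟨_, measurableSet_singleton _, rfl⟩
      · rw [dataSigma_eq_comap]
        exact (IndepFun_iff_Indep _ _ _).1 hXπ.symm
    have h3 : P[T σ] = (2 ^ n)⁻¹ := by
      rw [hT, integral_indicator_const _ (hSm σ), Measure.real, measure_signs_eq hπ hlaw hind]
      simp
    filter_upwards [h1, h2] with ω h1 h2
    rw [h1, Pi.mul_apply, h2, h3]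
  have hsum : P[∑ σ, A σ * T σ | dataSigma X] =ᵐ[P] ∑ σ, P[A σ * T σ | dataSigma X] :=
    condExp_finsetSum (fun σ _ => hATi σ) _
  have hall : ∀ᵐ ω ∂P, ∀ σ, P[A σ * T σ | dataSigma X] ω = A σ ω * (2 ^ n)⁻¹ :=
    ae_all_iff.2 hcond
  have h0 : pValue P π X =ᵐ[P] P[∑ σ, A σ * T σ | dataSigma X] := condExp_congr_ae hdecomp
  filter_upwards [h0, hsum, hall] with ω h0 h1 h2
  rw [h0, h1, Finset.sum_apply, flipProb]
  refine Finset.sum_congr rfl fun σ _ => ?_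
  rw [h2, tiltWeight_zero, mul_comm]

/-! ### Concentration of the empirical moments -/

lemma measure_abs_sum_sub_ge_le {Ω : Type*} [MeasurableSpace Ω] {P : Measure Ω} [IsProbabilityMeasure P] {n : ℕ}
    {Y : Fin n → Ω → ℝ} (hY : ∀ i, MemLp (Y i) 2 P)
    (hind : Pairwise fun i j => IndepFun (Y i) (Y j) P) {A r : ℝ} (hr : 0 < r)
    (hA : ∑ i, ∫ ω, Y i ω ^ 2 ∂P ≤ A) :
    P {ω | r ≤ |∑ i, Y i ω - ∑ i, ∫ ω, Y i ω ∂P|} ≤ ENNReal.ofReal (A / r ^ 2) := by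
  have h1 := meas_ge_le_variance_div_sq (memLp_finsetSum' Finset.univ fun i _ => hY i) hr
  have h2 : P[∑ i, Y i] = ∑ i, ∫ ω, Y i ω ∂P := by
    simp only [Finset.sum_apply]
    exact integral_finsetSum _ fun i _ => (hY i).integrable one_le_two
  rw [h2] at h1
  simp only [Finset.sum_apply] at h1
  refine h1.trans (ENNReal.ofReal_le_ofReal ?_)
  gcongr
  rw [IndepFun.variance_sum (fun i _ => hY i) fun i _ j _ hij => hind hij]
  refine le_trans (Finset.sum_le_sum fun i _ => ?_) hA
  exact variance_le_expectation_sq (hY i).1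

/-- Chebyshev for `∑ ε²`, whose variance is bounded by fourth moments, and for `∑ ε`; only Markov
for `∑ ε⁴`. The Markov term `(1 + C) / K` does not decay in `n` and must be made small through `K`.
-/
lemma measure_moments_bad_le {Ω : Type*} [MeasurableSpace Ω] {P : Measure Ω} [IsProbabilityMeasure P] {n : ℕ}
    (hn : 0 < n) {ε : Fin n → Ω → ℝ} (hε : ∀ i, Measurable (ε i))
    (hind : iIndepFun ε P) (hsymm : ∀ i, P.map (fun ω => -ε i ω) = P.map (ε i))
    {δ c C K t : ℝ} (hδ : 0 < δ) (hc : 0 < c) (hC : 0 ≤ C) (hK : 0 < K) (ht : 0 < t)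
    (h2 : ENNReal.ofReal c ≤ (n : ℝ≥0∞)⁻¹ * ∑ i, ∫⁻ ω, ENNReal.ofReal (ε i ω ^ 2) ∂P)
    (h4 : (n : ℝ≥0∞)⁻¹ * ∑ i, ∫⁻ ω, ENNReal.ofReal (|ε i ω| ^ (4 + δ)) ∂P ≤ ENNReal.ofReal C) :
    P {ω | ¬(c / 2 * n ≤ ∑ i, ε i ω ^ 2 ∧ ∑ i, ε i ω ^ 4 ≤ K * n ∧ |∑ i, ε i ω| ≤ t * n)} ≤
      ENNReal.ofReal ((1 + C) * n / (c / 2 * n) ^ 2 + (1 + C) / K +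
        (1 + C) * n / (t * n) ^ 2) := by
  have hn0 : (0 : ℝ) < n := by exact_mod_cast hn
  have hnE : (n : ℝ≥0∞) ≠ 0 := by exact_mod_cast hn.ne'
  have hnT : (n : ℝ≥0∞) ≠ ⊤ := ENNReal.natCast_ne_top n
  have hnR : (n : ℝ≥0∞) = ENNReal.ofReal n := (ENNReal.ofReal_natCast n).symm
  have h4' : ∑ i, ∫⁻ ω, ENNReal.ofReal (|ε i ω| ^ (4 + δ)) ∂P ≤ ENNReal.ofReal (n * C) := by
    rw [ENNReal.inv_mul_le_iff hnE hnT] at h4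
    rwa [ENNReal.ofReal_mul hn0.le, ← hnR]
  have hpm : ∀ i, AEStronglyMeasurable (fun ω => |ε i ω| ^ (4 + δ)) P := fun i =>
    (((hε i).abs).pow_const _).aestronglyMeasurable
  have hpnn : ∀ i ω, 0 ≤ |ε i ω| ^ (4 + δ) := fun i ω => by positivity
  have hpi : ∀ i, Integrable (fun ω => |ε i ω| ^ (4 + δ)) P := fun i => by
    refine (lintegral_ofReal_ne_top_iff_integrable (hpm i) (ae_of_all _ (hpnn i))).1 ?_
    exact ((Finset.single_le_sum (f := fun i => ∫⁻ ω, ENNReal.ofReal (|ε i ω| ^ (4 + δ)) ∂P)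
      (fun _ _ => zero_le) (Finset.mem_univ i)).trans_lt
        (h4'.trans_lt ENNReal.ofReal_lt_top)).ne
  have hpsum : ∑ i, ∫ ω, |ε i ω| ^ (4 + δ) ∂P ≤ n * C := by
    rw [← ENNReal.ofReal_le_ofReal_iff (by positivity), ENNReal.ofReal_sum_of_nonneg
      fun i _ => integral_nonneg (hpnn i)]
    refine le_trans (le_of_eq (Finset.sum_congr rfl fun i _ => ?_)) h4'
    exact ofReal_integral_eq_lintegral_ofReal (hpi i) (ae_of_all _ (hpnn i))
  have hpow : ∀ m : ℕ, m ≤ 4 → ∀ y : ℝ, |y| ^ m ≤ 1 + |y| ^ (4 + δ) := fun m hm y => by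
    have hy := abs_nonneg y
    have h0 : 0 ≤ |y| ^ (4 + δ) := by positivity
    rcases le_total |y| 1 with h | h
    · linarith [pow_le_one₀ hy h (n := m)]
    · have h3 : |y| ^ (m : ℝ) ≤ |y| ^ (4 + δ) := by
        refine Real.rpow_le_rpow_of_exponent_le h ?_
        have : (m : ℝ) ≤ 4 := by exact_mod_cast hm
        linarith
      rw [Real.rpow_natCast] at h3
      linarith
  have hint : ∀ m : ℕ, m ≤ 4 → ∀ i, Integrable (fun ω => |ε i ω| ^ m) P := fun m hm i =>
    ((integrable_const 1).add (hpi i)).mono' (((hε i).abs).pow_const m).aestronglyMeasurable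
      (ae_of_all _ fun ω => by
        rw [Real.norm_of_nonneg (by positivity)]; exact hpow m hm _)
  have hsum : ∀ m : ℕ, m ≤ 4 → ∑ i, ∫ ω, |ε i ω| ^ m ∂P ≤ (1 + C) * n := fun m hm => by
    calc ∑ i, ∫ ω, |ε i ω| ^ m ∂P ≤ ∑ i, (1 + ∫ ω, |ε i ω| ^ (4 + δ) ∂P) := by
          refine Finset.sum_le_sum fun i _ => ?_
          have h5 := integral_mono (hint m hm i) ((integrable_const 1).add (hpi i))
            fun ω => hpow m hm (ε i ω)
          refine h5.trans (le_of_eq ?_)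
          simp only [Pi.add_apply]
          rw [integral_add (integrable_const 1) (hpi i)]
          simp
      _ ≤ _ := by rw [Finset.sum_add_distrib]; simp; linarith
  have e2 : ∀ y : ℝ, |y| ^ 2 = y ^ 2 := fun y => sq_abs y
  have e4 : ∀ y : ℝ, |y| ^ 4 = y ^ 4 := fun y => by
    rw [← abs_pow, abs_of_nonneg (by positivity)]
  have hi2 := hint 2 (by norm_num)
  have hi4 := hint 4 le_rfl
  have hs2 := hsum 2 (by norm_num)
  have hs4 := hsum 4 le_rfl
  simp only [e2] at hi2 hs2
  simp only [e4] at hi4 hs4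
  have hlow : c * n ≤ ∑ i, ∫ ω, ε i ω ^ 2 ∂P := by
    rw [← ENNReal.ofReal_le_ofReal_iff (Finset.sum_nonneg fun i _ =>
      integral_nonneg fun ω => sq_nonneg _), ENNReal.ofReal_sum_of_nonneg
      fun i _ => integral_nonneg fun ω => sq_nonneg _]
    have h5 : ∑ i, ENNReal.ofReal (∫ ω, ε i ω ^ 2 ∂P) =
        ∑ i, ∫⁻ ω, ENNReal.ofReal (ε i ω ^ 2) ∂P := Finset.sum_congr rfl fun i _ =>
      ofReal_integral_eq_lintegral_ofReal (hi2 i) (ae_of_all _ fun ω => sq_nonneg _)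
    rw [h5, mul_comm, ENNReal.ofReal_mul hn0.le, ← hnR]
    calc (n : ℝ≥0∞) * ENNReal.ofReal c ≤ n * ((n : ℝ≥0∞)⁻¹ *
          ∑ i, ∫⁻ ω, ENNReal.ofReal (ε i ω ^ 2) ∂P) := by gcongr
      _ = _ := by rw [← mul_assoc, ENNReal.mul_inv_cancel hnE hnT, one_mul]
  -- Symmetry enters here, through centred errors.
  have hmean : ∀ i, ∫ ω, ε i ω ∂P = 0 := fun i => by
    have h5 : ∫ y, y ∂(P.map fun ω => -ε i ω) = ∫ y, y ∂(P.map (ε i)) := by rw [hsymm]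
    rw [integral_map (show Measurable fun ω => -ε i ω from (hε i).neg).aemeasurable (by fun_prop),
      integral_map (hε i).aemeasurable (by fun_prop), integral_neg] at h5
    linarith
  have hQ : P {ω | c / 2 * n ≤ |∑ i, ε i ω ^ 2 - ∑ i, ∫ ω, ε i ω ^ 2 ∂P|} ≤
      ENNReal.ofReal ((1 + C) * n / (c / 2 * n) ^ 2) := by
    refine measure_abs_sum_sub_ge_le (Y := fun i ω => ε i ω ^ 2) (fun i => ?_) ?_
      (by positivity) ?_
    · refine (memLp_two_iff_integrable_sq ((hε i).pow_const 2).aestronglyMeasurable).2 ?_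
      simpa only [← pow_mul] using hi4 i
    · intro i j hij
      exact (hind.indepFun hij).comp (measurable_id.pow_const 2) (measurable_id.pow_const 2)
    · simpa only [← pow_mul] using hs4
  have hM : P {ω | t * n ≤ |∑ i, ε i ω|} ≤ ENNReal.ofReal ((1 + C) * n / (t * n) ^ 2) := by
    have h5 := measure_abs_sum_sub_ge_le (P := P) (Y := ε)
      (fun i => (memLp_two_iff_integrable_sq (hε i).aestronglyMeasurable).2 (hi2 i))
      (fun i j hij => hind.indepFun hij) (by positivity : 0 < t * n) hs2
    simpa only [hmean, Finset.sum_const_zero, sub_zero] using h5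
  have hF : P {ω | K * n ≤ ∑ i, ε i ω ^ 4} ≤ ENNReal.ofReal ((1 + C) / K) := by
    have hi : Integrable (fun ω => ∑ i, ε i ω ^ 4) P := integrable_finsetSum _ fun i _ => hi4 i
    have h5 := mul_meas_ge_le_integral_of_nonneg
      (ae_of_all P fun ω => Finset.sum_nonneg fun i (_ : i ∈ Finset.univ) =>
        (by positivity : 0 ≤ ε i ω ^ 4)) hi (K * n)
    rw [integral_finsetSum _ fun i _ => hi4 i] at h5
    rw [← ofReal_measureReal]
    refine ENNReal.ofReal_le_ofReal ?_
    rw [le_div_iff₀ hK]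
    have h6 := h5.trans hs4
    nlinarith
  have hsub : {ω | ¬(c / 2 * n ≤ ∑ i, ε i ω ^ 2 ∧ ∑ i, ε i ω ^ 4 ≤ K * n ∧
      |∑ i, ε i ω| ≤ t * n)} ⊆
      ({ω | c / 2 * n ≤ |∑ i, ε i ω ^ 2 - ∑ i, ∫ ω, ε i ω ^ 2 ∂P|} ∪
        {ω | K * n ≤ ∑ i, ε i ω ^ 4}) ∪ {ω | t * n ≤ |∑ i, ε i ω|} := by
    intro ω hω
    by_contra hcon
    simp only [Set.mem_union, Set.mem_ofPred_eq, not_or, not_le] at hcon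
    refine hω ⟨?_, hcon.1.2.le, hcon.2.le⟩
    have := (abs_lt.1 hcon.1.1).1
    linarith
  refine (measure_mono hsub).trans ((measure_union_le _ _).trans ?_)
  rw [ENNReal.ofReal_add (by positivity) (by positivity),
    ENNReal.ofReal_add (by positivity) (by positivity)]
  exact add_le_add ((measure_union_le _ _).trans (add_le_add hQ hF)) hM

/-! ### The good event -/

/-- From `(m + y)² ≥ y²/2 - m²` and `m² ≤ c/8` the squares sum to at least `c n / 8`; from `(m + y)⁴
≤ 8 (m⁴ + y⁴)` the fourth powers sum to at most `8 (K + 1) n`, and the quotient is the constant `64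
(K + 1) / c`. Shift and errors each contribute at most `c a n / 16` to the sum. -/
lemma moments_of_shift {n : ℕ} (y : Fin n → ℝ) {m a c K t : ℝ} (hn : 0 < n) (hc : 0 < c)
    (hm1 : |m| ≤ 1) (hma : |m| ≤ c * a / 16) (hm2 : m ^ 2 ≤ c / 8) (hK : 0 ≤ K)
    (ht : t = c * a / 16) (ha : 0 < a) (hna : 8 / (c * a) ≤ n)
    (h2 : c / 2 * n ≤ ∑ i, y i ^ 2) (h4 : ∑ i, y i ^ 4 ≤ K * n) (h1 : |∑ i, y i| ≤ t * n) :
    a⁻¹ ≤ ∑ i, (m + y i) ^ 2 ∧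
      ∑ i, (m + y i) ^ 4 ≤ 64 * (K + 1) / c * ∑ i, (m + y i) ^ 2 ∧
      |∑ i, (m + y i)| ≤ a * ∑ i, (m + y i) ^ 2 := by
  have hn0 : (0 : ℝ) < n := by exact_mod_cast hn
  have hlow : c / 8 * n ≤ ∑ i, (m + y i) ^ 2 := by
    have h5 : ∑ i, (y i ^ 2 / 2 - m ^ 2) ≤ ∑ i, (m + y i) ^ 2 :=
      Finset.sum_le_sum fun i _ => by nlinarith [sq_nonneg (2 * m + y i)]
    rw [Finset.sum_sub_distrib, ← Finset.sum_div] at h5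
    simp only [Finset.sum_const, Finset.card_univ, Fintype.card_fin, nsmul_eq_mul] at h5
    nlinarith
  have hup : ∑ i, (m + y i) ^ 4 ≤ 8 * (K + 1) * n := by
    have hm4 : m ^ 4 ≤ 1 := by
      rw [← Even.pow_abs (by decide : Even 4)]
      exact pow_le_one₀ (abs_nonneg m) hm1
    have h5 : ∑ i, (m + y i) ^ 4 ≤ ∑ i, (8 * y i ^ 4 + 8) :=
      Finset.sum_le_sum fun i _ => by
        have h6 : (m + y i) ^ 2 ≤ 2 * (m ^ 2 + y i ^ 2) := by nlinarith [sq_nonneg (m - y i)]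
        have h7 := pow_le_pow_left₀ (sq_nonneg _) h6 2
        nlinarith [sq_nonneg (m ^ 2 - y i ^ 2)]
    rw [Finset.sum_add_distrib, ← Finset.mul_sum] at h5
    simp only [Finset.sum_const, Finset.card_univ, Fintype.card_fin, nsmul_eq_mul] at h5
    nlinarith
  refine ⟨?_, ?_, ?_⟩
  · refine le_trans ?_ hlow
    rw [div_le_iff₀ (by positivity)] at hna
    rw [inv_le_iff_one_le_mul₀ ha]
    nlinarith
  · calc ∑ i, (m + y i) ^ 4 ≤ 8 * (K + 1) * n := hup
      _ = 64 * (K + 1) / c * (c / 8 * n) := by field_simp; norm_num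
      _ ≤ _ := by gcongr
  · calc |∑ i, (m + y i)| = |n * m + ∑ i, y i| := by simp [Finset.sum_add_distrib]
      _ ≤ n * |m| + |∑ i, y i| := by
        refine (abs_add_le _ _).trans ?_
        rw [abs_mul, Nat.abs_cast]
      _ ≤ n * (c * a / 16) + t * n := by gcongr
      _ = a * (c / 8 * n) := by rw [ht]; ring
      _ ≤ _ := by gcongr

lemma tendsto_error_zero {b r : ℝ} (hr : 0 < r) :
    Tendsto (fun n : ℕ => b * n / (r * n) ^ 2) atTop (𝓝 0) := by
  have h := (tendsto_const_div_atTop_nhds_zero_nat (b / r ^ 2))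
  refine h.congr' ?_
  filter_upwards [eventually_gt_atTop 0] with n hn
  have hn0 : (n : ℝ) ≠ 0 := by exact_mod_cast hn.ne'
  field_simp

/-- With probability close to one, the data satisfy the moment bounds of
`exists_uniform_bound`. -/
lemma exists_forall_eventually_measure_le {Ω : Type*} [MeasurableSpace Ω] {P : Measure Ω}
    [IsProbabilityMeasure P] {μ : ℕ → ℝ} {ε : (n : ℕ) → Fin n → Ω → ℝ}
    (hε_meas : ∀ n i, Measurable (ε n i)) (hε_indep : ∀ n, iIndepFun (ε n) P)
    (hε_symm : ∀ n i, P.map (fun ω => -ε n i ω) = P.map (ε n i))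
    (h_second : 0 < liminf (fun n : ℕ =>
      (n : ℝ≥0∞)⁻¹ * ∑ i, ∫⁻ ω, ENNReal.ofReal (ε n i ω ^ 2) ∂P) atTop)
    (h_fourth : ∃ δ : ℝ, 0 < δ ∧ limsup (fun n : ℕ =>
      (n : ℝ≥0∞)⁻¹ * ∑ i, ∫⁻ ω, ENNReal.ofReal (|ε n i ω| ^ (4 + δ)) ∂P) atTop < ⊤)
    (hμ : Tendsto μ atTop (𝓝 0)) {ρ : ℝ} (hρ : 0 < ρ) :
    ∃ D : ℝ, ∀ a : ℝ, 0 < a → ∀ᶠ n in atTop,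
      P {ω | ¬(a⁻¹ ≤ ∑ i, (μ n + ε n i ω) ^ 2 ∧
        ∑ i, (μ n + ε n i ω) ^ 4 ≤ D * ∑ i, (μ n + ε n i ω) ^ 2 ∧
        |∑ i, (μ n + ε n i ω)| ≤ a * ∑ i, (μ n + ε n i ω) ^ 2)} ≤ ENNReal.ofReal ρ := by
  obtain ⟨δ, hδ, hlim⟩ := h_fourth
  obtain ⟨c, hc0, hc1⟩ := ENNReal.lt_iff_exists_nnreal_btwn.1 h_second
  obtain ⟨C, hC0, -⟩ := ENNReal.lt_iff_exists_nnreal_btwn.1 hlim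
  have hc : 0 < (c : ℝ) := by exact_mod_cast hc0
  have h2 := eventually_lt_of_lt_liminf hc1
  have h4 := eventually_lt_of_limsup_lt hC0
  -- This makes the Markov term `ρ/2`. So `D` depends on `ρ` but not on `a`, as the order of
  -- quantifiers requires.
  set K : ℝ := 2 * (1 + C) / ρ with hK
  have hC : 0 ≤ (C : ℝ) := C.2
  have hKpos : 0 < K := by positivity
  refine ⟨64 * (K + 1) / c, fun a ha => ?_⟩
  set t : ℝ := c * a / 16 with ht
  have htpos : 0 < t := by positivity
  have hterms : Tendsto (fun n : ℕ => (1 + (C : ℝ)) * n / (c / 2 * n) ^ 2 + (1 + C) / K +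
      (1 + C) * n / (t * n) ^ 2) atTop (𝓝 (0 + (1 + C) / K + 0)) :=
    ((tendsto_error_zero (half_pos hc)).add tendsto_const_nhds).add (tendsto_error_zero htpos)
  have hKρ : 0 + (1 + C) / K + 0 < ρ := by
    have : (1 + C) / K = ρ / 2 := by rw [hK]; field_simp
    linarith
  have hμabs : Tendsto (fun n => |μ n|) atTop (𝓝 0) := by simpa using hμ.abs
  have hμsq : Tendsto (fun n => μ n ^ 2) atTop (𝓝 0) := by simpa using hμ.pow 2
  filter_upwards [h2, h4, hterms.eventually_lt_const hKρ,
    hμabs.eventually_le_const one_pos, hμabs.eventually_le_const htpos,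
    hμsq.eventually_le_const (by positivity : (0 : ℝ) < c / 8),
    eventually_gt_atTop 0,
    tendsto_natCast_atTop_atTop.eventually_ge_atTop (8 / (c * a))]
    with n h2 h4 h5 h6 h7 h8 hn h9
  have hbad := measure_moments_bad_le hn (hε_meas n) (hε_indep n) (hε_symm n) hδ hc hC hKpos
    htpos (by rw [ENNReal.ofReal_coe_nnreal]; exact h2.le)
    (by rw [ENNReal.ofReal_coe_nnreal]; exact h4.le)
  refine le_trans (measure_mono ?_) (hbad.trans (ENNReal.ofReal_le_ofReal h5.le))
  intro ω hω hcon
  exact hω (moments_of_shift _ hn hc h6 h7 h8 hKpos.le ht ha h9 hcon.1 hcon.2.1 hcon.2.2)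

end SignFlip

end

/-! ### The triangular array: combining the uniform bound with concentration -/

theorem theorem2 {Ω : Type*} [MeasurableSpace Ω] (P : Measure Ω) [IsProbabilityMeasure P]
    (μ : ℕ → ℝ) (ε X π : (n : ℕ) → Fin n → Ω → ℝ)
    -- the location model, with independent and symmetric errors in each row
    (hX : ∀ n i ω, X n i ω = μ n + ε n i ω)
    (hε_meas : ∀ n i, Measurable (ε n i))
    (hε_indep : ∀ n, iIndepFun (ε n) P)
    (hε_symm : ∀ n i, P.map (fun ω => -ε n i ω) = P.map (ε n i))
    -- the signs: i.i.d. Rademacher in each row, and independent of the data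
    (hπ_meas : ∀ n i, Measurable (π n i))
    (hπ_law : ∀ n i, P.map (π n i) = SignFlip.rademacher)
    (hπ_indep : ∀ n, iIndepFun (π n) P)
    (hεπ_indep : ∀ n, IndepFun (fun ω i => ε n i ω) (fun ω i => π n i ω) P)
    -- the average second moment is bounded below
    (h_second : 0 < liminf (fun n : ℕ =>
      (n : ℝ≥0∞)⁻¹ * ∑ i, ∫⁻ ω, ENNReal.ofReal (ε n i ω ^ 2) ∂P) atTop)
    -- the average `(4 + δ)`-th absolute moment is bounded above
    (h_fourth : ∃ δ : ℝ, 0 < δ ∧ limsup (fun n : ℕ =>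
      (n : ℝ≥0∞)⁻¹ * ∑ i, ∫⁻ ω, ENNReal.ofReal (|ε n i ω| ^ (4 + δ)) ∂P) atTop < ⊤)
    (hμ : Tendsto μ atTop (𝓝 0)) :
    Tendsto (fun n => P {ω | ∃! s, s ∈ SignFlip.solutionSet (fun i => X n i ω)}) atTop (𝓝 1) ∧
    SignFlip.VanishingRelativeError P
      (fun n => SignFlip.pValue P (π n) (X n))
      (fun n ω => SignFlip.lugannaniRice (fun i => X n i ω)) := by
  have hbound : ∀ D η : ℝ, 0 < η → ∃ a > 0, ∀ n ω,
      (a⁻¹ ≤ ∑ i, (μ n + ε n i ω) ^ 2 ∧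
        ∑ i, (μ n + ε n i ω) ^ 4 ≤ D * ∑ i, (μ n + ε n i ω) ^ 2 ∧
        |∑ i, (μ n + ε n i ω)| ≤ a * ∑ i, (μ n + ε n i ω) ^ 2) →
      (∃! s, s ∈ SignFlip.solutionSet fun i => X n i ω) ∧
        |SignFlip.flipProb (fun i => X n i ω) / SignFlip.lugannaniRice (fun i => X n i ω) - 1|
          ≤ η := by
    intro D η hη
    obtain ⟨a, ha, h⟩ := SignFlip.exists_uniform_bound D hη
    refine ⟨a, ha, fun n ω hω => ?_⟩
    simp only [← hX] at hω
    exact h n _ hω.1 hω.2.1 hω.2.2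
  -- Both conclusions are instances. The inclusion is only almost sure because `pValue` is a
  -- conditional expectation. The choices are made in the order `ρ`, then `D`, then `a` from `D` and
  -- `η`.
  have hbad : ∀ (B : ℕ → Set Ω) (η : ℝ), 0 < η →
      (∀ n, ∀ᵐ ω ∂P, ω ∈ B n → ¬((∃! s, s ∈ SignFlip.solutionSet fun i => X n i ω) ∧
        |SignFlip.flipProb (fun i => X n i ω) / SignFlip.lugannaniRice (fun i => X n i ω) - 1|
          ≤ η)) → Tendsto (fun n => P (B n)) atTop (𝓝 0) := by
    intro B η hη hB
    refine ENNReal.tendsto_nhds_zero.2 fun τ hτ => ?_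
    obtain ⟨ρ, hρ0, hρτ⟩ := ENNReal.lt_iff_exists_nnreal_btwn.1 hτ
    have hρ : 0 < (ρ : ℝ) := by exact_mod_cast hρ0
    obtain ⟨D, hD⟩ := SignFlip.exists_forall_eventually_measure_le hε_meas hε_indep hε_symm
      h_second h_fourth hμ hρ
    obtain ⟨a, ha, h⟩ := hbound D η hη
    filter_upwards [hD a ha] with n hn
    rw [ENNReal.ofReal_coe_nnreal] at hn
    refine le_trans (measure_mono_ae ?_) (hn.trans hρτ.le)
    filter_upwards [hB n] with ω hω hωB hcon
    exact hω hωB (h n ω hcon)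
  constructor
  · have h0 := hbad (fun n => {ω | ∃! s, s ∈ SignFlip.solutionSet fun i => X n i ω}ᶜ) 1 one_pos
      fun n => ae_of_all _ fun ω hω hcon => hω hcon.1
    have h1 := ENNReal.Tendsto.sub (tendsto_const_nhds (x := (1 : ℝ≥0∞)) (f := atTop)) h0
      (Or.inl ENNReal.one_ne_top)
    rw [tsub_zero] at h1
    refine tendsto_of_tendsto_of_tendsto_of_le_of_le h1 tendsto_const_nhds (fun n => ?_)
      fun n => prob_le_one
    refine tsub_le_iff_right.2 ?_
    rw [← measure_univ (μ := P), ← Set.union_compl_self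
      {ω | ∃! s, s ∈ SignFlip.solutionSet fun i => X n i ω}]
    exact measure_union_le _ _
  · intro η hη
    refine hbad _ η hη fun n => ?_
    have hXn : X n = fun i ω => μ n + ε n i ω := by ext i ω; exact hX n i ω
    have hXm : ∀ i, Measurable (X n i) := fun i => by
      rw [hXn]; exact (hε_meas n i).const_add _
    have hXπ : IndepFun (fun ω i => X n i ω) (fun ω i => π n i ω) P := by
      rw [hXn]
      exact (hεπ_indep n).comp (φ := fun (y : Fin n → ℝ) i => μ n + y i) (ψ := id)
        (by fun_prop) measurable_id
    filter_upwards [SignFlip.pValue_ae_eq_flipProb hXm (hπ_meas n) (hπ_law n) (hπ_indep n) hXπ]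
      with ω hω hωB hcon
    have hlt : η < |SignFlip.pValue P (π n) (X n) ω /
      SignFlip.lugannaniRice (fun i => X n i ω) - 1| := hωB
    rw [hω] at hlt
    exact absurd hcon.2 (not_le.2 hlt)
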